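/- **Amplification lemma for MA.** Inputs are nonempty binary strings $\eta$ with length $|\eta|\ge 1$, and a decision problem $Q$ assigns to every input $\eta$ a value $Q(\eta)\in\{0,1\}$. For functions $c,s:\mathbb N\to\mathbb R$, let $\mathrm{MA}(c,s)$ be the class of decision problems $Q$ for which there are polynomials $p,q$ with coefficients in $\mathbb N$ and a deterministic polynomial-time Turing machine $V$ (on triples $(\eta,X,r)$ of binary strings, with one output bit) such that for every input $\eta$: * if $Q(\eta)=1$, then there is a witness $X\in\{0,1\}^{p(|\eta|)}$ with $\Pr_r[V(\eta,X,r)=1]\ge c(|\eta|)$; * if $Q(\eta)=0$, then for all witnesses $X\in\{0,1\}^{p(|\eta|)}$ we have $\Pr_r[V(\eta,X,r)=1]\le s(|\eta|)$, where $r$ is uniformly distributed in $\{0,1\}^{q(|\eta|)}$. Let $g\ge 0$ be a real constant. Then 1. for every $c:\mathbb N\to\mathbb R$ with $c(n)>0$ and $c(n)-1/n^{g}<1$ for all $n\ge1$ that is efficiently approximable (there is a function $a:\mathbb N\times\mathbb N\to\mathbb N$, computable by a Turing machine in polynomial time when arguments and values are written in unary, with $|a(n,m)/m-c(n)|\le 1/m$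 for all $n,m\ge 1$), $$\mathrm{MA}\bigl(c,\;c-1/|\eta|^{g}\bigr)\subseteq \mathrm{MA}(2/3,1/3);$$ 2. $$\mathrm{MA}(2/3,1/3)=\mathrm{MA}\bigl(1-e^{-|\eta|^{g}},\;e^{-|\eta|^{g}}\bigr).$$ -/

import Mathlib

namespace MerlinArthur

/-- An input: a nonempty binary string `η`; its length `|η|` is at least `1`. -/
abbrev Input : Type := {η : List Bool // η ≠ []}

/-- A decision problem assigns the answer `Q(η) = 1` (`true`) or `Q(η) = 0` (`false`) to every
input `η`. -/
abbrev DecisionProblem : Type := Input → Bool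

/-- The word over `{0, 1, #}` (with `none` as the separator `#`) that is written on the input tape
for the triple `(η, X, r)`, namely `η # X # r`. -/
def encodeTriple (t : List Bool × List Bool × List Bool) : List (Option Bool) :=
  t.1.map some ++ none :: (t.2.1.map some ++ none :: t.2.2.map some)

/-- `V` is computable by a deterministic multi-stack Turing machine in time polynomial in the length
of the word `η # X # r`; the output is a single bit. -/
def IsPolyTimeVerifier (V : List Bool × List Bool × List Bool → Bool) : Prop :=
  Nonempty (Turing.TM2ComputableInPolyTime encodeTriple Computability.encodeBool V)

/-- `Pr (V(η, X) = 1)`: the probability that `V` outputs `1` on input `η` and witness `X` when its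
random string `r` consists of `m` independent fair coin tosses. -/
noncomputable def acceptProb (V : List Bool × List Bool × List Bool → Bool) (m : ℕ)
    (η X : List Bool) : ℝ :=
  (Fintype.card {r : Fin m → Bool // V (η, X, List.ofFn r) = true} : ℝ) / 2 ^ m

/-- The class `MA(c, s)`, with completeness `c` and soundness `s` that may depend on `|η|`. The
witnesses have length `p(|η|)` and the verifier tosses `q(|η|)` coins, for polynomials `p`, `q`. -/
def MA (c s : ℕ → ℝ) : Set DecisionProblem :=
  {Q | ∃ (V : List Bool × List Bool × List Bool → Bool) (p q : Polynomial ℕ),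
    IsPolyTimeVerifier V ∧
    ∀ η : Input,
      (Q η = true → ∃ X : List Bool, X.length = p.eval η.1.length ∧
        c η.1.length ≤ acceptProb V (q.eval η.1.length) η.1 X) ∧
      (Q η = false → ∀ X : List Bool, X.length = p.eval η.1.length →
        acceptProb V (q.eval η.1.length) η.1 X ≤ s η.1.length)}

/-- The binary word `1ⁿ 0 1ᵐ`. -/
def encodeUnaryPair (t : ℕ × ℕ) : List Bool :=
  List.replicate t.1 true ++ false :: List.replicate t.2 true

/-- The threshold `c(n)` can be approximated efficiently: from `1ⁿ 0 1ᵐ`, with `n, m ≥ 1`, a Turing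
machine computes in polynomial time a natural number `a` (in unary) with `|a / m - c(n)| ≤ 1 / m`. -/
def IsPolyTimeApproximable (c : ℕ → ℝ) : Prop :=
  ∃ a : ℕ × ℕ → ℕ,
    Nonempty (Turing.TM2ComputableInPolyTime encodeUnaryPair
      (fun k : ℕ => List.replicate k true) a) ∧
    ∀ n m : ℕ, 1 ≤ n → 1 ≤ m → |(a (n, m) : ℝ) / m - c n| ≤ 1 / m

end MerlinArthur

/-!
The amplified verifier `amplify` runs the given verifier `V` on `m` successive blocks of coins and
accepts if the number of accepting runs, plus a slack `d`, is at least `a (n, m)`, the approximation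
of `m * c n`. All parts of the theorem are instances of `MA_subset_of_gap`: if the acceptance
probabilities for the two answers are separated by a gap `1 / (8 * n ^ G)` below an efficiently
approximable threshold `c`, then suitable polynomials `m` and `d` bring the error down to
`exp (-2 * n ^ H)`. The number of accepting runs is controlled by a Chernoff bound
(`card_deviation_le`), proved by counting: the exponential moment of the count is the `m`-th power
of that of a single run. For the second part the threshold is the constant `1 / 2`, and both
`(2/3, 1/3)` and `(1 - exp (-n ^ g), exp (-n ^ g))` leave a constant gap around it, since
`exp (-1) < 3 / 8`.

The amplified verifier has to be realized by a stack machine that calls the machines for `V` and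
for `a` as subroutines (`isPolyTimeVerifier_amplify`). Programs are composed from fragments
(`Frag`), pieces of code that are left by halting. `Frag.Runs S T n` says that a fragment takes the
work stacks from `S` to `T` within `n` steps while all subroutines are idle; there is a rule for
sequential composition, for loops, and for calls of a subroutine (`Frag.runs_call`). Numbers are
kept in unary, so that polynomials are evaluated by nested loops
(`Frag.exists_runs_polynomial`).
-/

set_option linter.unusedSectionVars false

namespace MerlinArthur

open Turing Function

/-! ### Bounded reachability for stack machines -/

section Reach

variable {K : Type} [DecidableEq K] {Γ : K → Type} {Λ Λ' σ : Type}

/-- `Reach M n a b`: the program `M` leads from configuration `a` to `b` in at most `n` steps. -/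
inductive Reach (M : Λ → TM2.Stmt Γ Λ σ) : ℕ → TM2.Cfg Γ Λ σ → TM2.Cfg Γ Λ σ → Prop
  | refl (n : ℕ) (a : TM2.Cfg Γ Λ σ) : Reach M n a a
  | head {n : ℕ} {a b c : TM2.Cfg Γ Λ σ} :
      TM2.step M a = some b → Reach M n b c → Reach M (n + 1) a c

namespace Reach

variable {M : Λ → TM2.Stmt Γ Λ σ} {a b c : TM2.Cfg Γ Λ σ} {m n : ℕ}

theorem mono (h : Reach M m a b) (hmn : m ≤ n) : Reach M n a b := by
  induction h generalizing n with
  | refl => exact .refl _ _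
  | head hs _ ih =>
    obtain ⟨n, rfl⟩ : ∃ n', n = n' + 1 := ⟨n - 1, by omega⟩
    exact .head hs (ih (by omega))

theorem trans (h : Reach M m a b) (h' : Reach M n b c) : Reach M (m + n) a c := by
  induction h with
  | refl => exact h'.mono (by omega)
  | head hs _ ih => exact (Reach.head hs (ih h')).mono (by omega)

theorem single (h : TM2.step M a = some b) : Reach M 1 a b := .head h (.refl 0 b)

theorem exists_iterate (h : Reach M n a b) :
    ∃ k ≤ n, (flip bind (TM2.step M))^[k] (some a) = some b := by
  induction h with
  | refl => exact ⟨0, Nat.zero_le _, rfl⟩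
  | head hs _ ih =>
    obtain ⟨k, hk, hb⟩ := ih
    refine ⟨k + 1, by omega, ?_⟩
    rw [iterate_succ_apply]
    change (flip bind (TM2.step M))^[k] (TM2.step M _) = _
    rw [hs, hb]

theorem of_iterate {k : ℕ} (h : (flip bind (TM2.step M))^[k] (some a) = some b) :
    Reach M k a b := by
  induction k generalizing a with
  | zero => obtain rfl : a = b := by simpa using h
            exact .refl _ _
  | succ k ih =>
    rw [iterate_succ_apply] at h
    change (flip bind (TM2.step M))^[k] (TM2.step M a) = _ at h
    cases hs : TM2.step M a with
    | none =>
      have hn : ∀ k, (flip bind (TM2.step M))^[k] none = none := fun k => by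
        induction k with
        | zero => rfl
        | succ k ih => rw [iterate_succ_apply]; exact ih
      rw [hs, hn] at h
      cases h
    | some d => exact .head hs (ih (hs ▸ h))

end Reach

/-- Rename the labels of a statement by `f`, and let it jump to `x` (or still halt, for
`x = none`) where it used to halt. -/
def redirect (f : Λ → Λ') (x : Option Λ') : TM2.Stmt Γ Λ σ → TM2.Stmt Γ Λ' σ
  | .push k g q => .push k g (redirect f x q)
  | .peek k g q => .peek k g (redirect f x q)
  | .pop k g q => .pop k g (redirect f x q)
  | .load g q => .load g (redirect f x q)
  | .branch g q₁ q₂ => .branch g (redirect f x q₁) (redirect f x q₂)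
  | .goto l => .goto fun v => f (l v)
  | .halt => x.elim .halt fun y => .goto fun _ => y

/-- The effect of `redirect` on configurations. -/
def redirectCfg (f : Λ → Λ') (x : Option Λ') (c : TM2.Cfg Γ Λ σ) : TM2.Cfg Γ Λ' σ :=
  ⟨c.l.elim x fun l => some (f l), c.var, c.stk⟩

theorem stepAux_redirect (f : Λ → Λ') (x : Option Λ') (q : TM2.Stmt Γ Λ σ) (v : σ)
    (S : ∀ k, List (Γ k)) :
    TM2.stepAux (redirect f x q) v S = redirectCfg f x (TM2.stepAux q v S) := by
  induction q generalizing v S with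
  | branch g q₁ q₂ ih₁ ih₂ => simp only [redirect, TM2.stepAux]; cases g v <;> simp [ih₁, ih₂]
  | goto l => rfl
  | halt => cases x <;> rfl
  | _ => simp_all [redirect]

theorem Reach.redirect {M : Λ → TM2.Stmt Γ Λ σ} {M' : Λ' → TM2.Stmt Γ Λ' σ} {f : Λ → Λ'}
    {x : Option Λ'} (hM : ∀ l, M' (f l) = MerlinArthur.redirect f x (M l)) {n : ℕ}
    {a b : TM2.Cfg Γ Λ σ} (h : Reach M n a b) :
    Reach M' n (redirectCfg f x a) (redirectCfg f x b) := by
  induction h with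
  | refl => exact .refl _ _
  | @head n a b c hs _ ih =>
    refine .head ?_ ih
    obtain ⟨_ | l, v, S⟩ := a
    · cases hs
    · simp only [TM2.step, Option.some.injEq] at hs
      simp only [redirectCfg, Option.elim, TM2.step, hM, stepAux_redirect, hs]

end Reach

/-! ### Program fragments with subroutines -/

section Frag

variable {K A ι : Type} [DecidableEq K] [DecidableEq ι] (O : ι → FinTM2)

/-- The stacks of a program with work stacks `K` and subroutines `O`: besides its work stacks it
owns all stacks of each of the subroutines. -/
abbrev StackIdx (K : Type) (O : ι → FinTM2) : Type := K ⊕ Σ i, (O i).K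

/-- The stack alphabets: `A` on all work stacks, and the original ones on the subroutines'
stacks. -/
@[reducible] def StackAlph (K A : Type) (O : ι → FinTM2) : StackIdx K O → Type
  | .inl _ => A
  | .inr x => (O x.1).Γ x.2

/-- The internal states: a register for the symbol that was popped last, and an internal state
for each subroutine. -/
abbrev IntState (A : Type) (O : ι → FinTM2) : Type := Option A × ∀ i, (O i).σ

/-- A program fragment is a finite labelled program; control leaves the fragment where it halts. -/
structure Frag (K A : Type) (O : ι → FinTM2) where
  /-- the labels -/
  Λ : Type
  /-- there are finitely many labels -/
  fin : Fintype Λ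
  /-- the label at which control enters the fragment -/
  entry : Λ
  /-- the code -/
  code : Λ → TM2.Stmt (StackAlph K A O) Λ (IntState A O)

variable {O}

/-- The contents of all stacks, assembled from those of the work stacks and of the subroutines. -/
def joinStacks (S : K → List A) (T : ∀ i k, List ((O i).Γ k)) : ∀ k, List (StackAlph K A O k)
  | .inl k => S k
  | .inr x => T x.1 x.2

@[simp] theorem joinStacks_inl (S : K → List A) (T : ∀ i k, List ((O i).Γ k)) (k : K) :
    joinStacks S T (.inl k) = S k := rfl

@[simp] theorem joinStacks_inr (S : K → List A) (T : ∀ i k, List ((O i).Γ k)) (i : ι)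
    (k : (O i).K) : joinStacks S T (.inr ⟨i, k⟩) = T i k := rfl

theorem update_joinStacks_inl (S : K → List A) (T : ∀ i k, List ((O i).Γ k)) (k : K)
    (l : List A) :
    update (joinStacks S T) (.inl k) l = joinStacks (update S k l) T := by
  funext j
  rcases j with j | j
  · by_cases h : j = k
    · subst h; simp
    · rw [update_of_ne (by simpa using h)]; simp [h]
  · rw [update_of_ne (by simp)]; rfl

theorem update_joinStacks_inr (S : K → List A) (T : ∀ i k, List ((O i).Γ k)) (i : ι)
    (k : (O i).K) (l : List ((O i).Γ k)) :
    update (joinStacks S T) (.inr ⟨i, k⟩) l =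
      joinStacks S (update T i (update (T i) k l)) := by
  funext j
  rcases j with j | ⟨j, k'⟩
  · rw [update_of_ne (by simp)]; rfl
  · by_cases h : j = i
    · subst h
      by_cases h' : k' = k
      · subst h'; simp
      · rw [update_of_ne (by simpa using h')]; simp [h']
    · rw [update_of_ne (by simp [h])]; simp [h]

/-- The states of the subroutines while none of them is running. -/
def idleState (O : ι → FinTM2) : ∀ i, (O i).σ := fun i => (O i).initialState

/-- The stacks of the subroutines while none of them is running. -/
def idleStacks (O : ι → FinTM2) : ∀ i k, List ((O i).Γ k) := fun _ _ => []

namespace Frag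

/-- `F.Exec n v S w T`: entered with state `v` and stacks `S`, the fragment `F` is left with state
`w` and stacks `T` after at most `n` steps. -/
def Exec (F : Frag K A O) (n : ℕ) (v : IntState A O) (S : ∀ k, List (StackAlph K A O k))
    (w : IntState A O) (T : ∀ k, List (StackAlph K A O k)) : Prop :=
  Reach F.code n ⟨some F.entry, v, S⟩ ⟨none, w, T⟩

/-- `F.Runs S T n`: while all subroutines are idle, the fragment `F` transforms the contents `S` of
the work stacks into `T` in at most `n` steps, whatever the register holds. -/
def Runs (F : Frag K A O) (S T : K → List A) (n : ℕ) : Prop :=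
  ∀ x, ∃ y, F.Exec n (x, idleState O) (joinStacks S (idleStacks O)) (y, idleState O)
    (joinStacks T (idleStacks O))

theorem Runs.mono {F : Frag K A O} {S T : K → List A} {m n : ℕ} (h : F.Runs S T m) (hmn : m ≤ n) :
    F.Runs S T n := fun x => (h x).imp fun _ hy => Reach.mono hy hmn

/-- The fragment that does nothing. -/
def skip : Frag K A O := ⟨Unit, inferInstance, (), fun _ => .halt⟩

theorem runs_skip (S : K → List A) : (skip : Frag K A O).Runs S S 1 :=
  fun x => ⟨x, Reach.single rfl⟩

/-- Push the symbol `a` on the work stack `k`. -/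
def push (k : K) (a : A) : Frag K A O :=
  ⟨Unit, inferInstance, (), fun _ => .push (.inl k) (fun _ => a) .halt⟩

theorem runs_push (k : K) (a : A) (S : K → List A) :
    (push k a : Frag K A O).Runs S (update S k (a :: S k)) 1 := fun x =>
  ⟨x, Reach.single (by
    simp only [push, TM2.step, TM2.stepAux, joinStacks_inl]
    rw [update_joinStacks_inl])⟩

/-- Run `F`, then `G`. -/
def seq (F G : Frag K A O) : Frag K A O where
  Λ := F.Λ ⊕ G.Λ
  fin := by have := F.fin; have := G.fin; infer_instance
  entry := .inl F.entry
  code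
    | .inl l => redirect .inl (some (.inr G.entry)) (F.code l)
    | .inr l => redirect .inr none (G.code l)

theorem Exec.seq {F G : Frag K A O} {m n : ℕ} {v₁ v₂ v₃ : IntState A O}
    {S₁ S₂ S₃ : ∀ k, List (StackAlph K A O k)} (h : F.Exec m v₁ S₁ v₂ S₂)
    (h' : G.Exec n v₂ S₂ v₃ S₃) : (F.seq G).Exec (m + n) v₁ S₁ v₃ S₃ :=
  Reach.trans (Reach.redirect (M' := (F.seq G).code) (f := .inl) (x := some (.inr G.entry))
    (fun _ => rfl) h)
    (Reach.redirect (M' := (F.seq G).code) (f := .inr) (x := none) (fun _ => rfl) h')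

theorem Runs.seq {F G : Frag K A O} {m n : ℕ} {S₁ S₂ S₃ : K → List A} (h : F.Runs S₁ S₂ m)
    (h' : G.Runs S₂ S₃ n) : (F.seq G).Runs S₁ S₃ (m + n) := fun x => by
  obtain ⟨y, hy⟩ := h x
  obtain ⟨z, hz⟩ := h' y
  exact ⟨z, hy.seq hz⟩

/-- Pop a symbol `o` from the work stack `k` (`o = none` if the stack is empty) and run `c o`; then
start again if `go o = true`, and leave otherwise. -/
def popLoop [Fintype A] (k : K) (c : Option A → Frag K A O) (go : Option A → Bool) :
    Frag K A O where
  Λ := Option (Σ o, (c o).Λ)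
  fin := by have := fun o => (c o).fin; infer_instance
  entry := none
  code
    | none => .pop (.inl k) (fun v x => (x, v.2)) (.goto fun v => some ⟨v.1, (c v.1).entry⟩)
    | some ⟨o, l⟩ => redirect (fun l => some ⟨o, l⟩) (if go o then some none else none) ((c o).code l)

section popLoop

variable [Fintype A] {k : K} {c : Option A → Frag K A O} {go : Option A → Bool}

theorem reach_popLoop {S T : K → List A} {n : ℕ}
    (h : (c (S k).head?).Runs (update S k (S k).tail) T n) (x : Option A) :
    ∃ y, Reach (popLoop k c go).code (n + 1)
      ⟨some none, (x, idleState O), joinStacks S (idleStacks O)⟩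
      ⟨if go (S k).head? then some none else none, (y, idleState O),
        joinStacks T (idleStacks O)⟩ := by
  obtain ⟨y, hy⟩ := h (S k).head?
  refine ⟨y, .head ?_ (Reach.redirect (M' := (popLoop k c go).code)
    (f := fun l => some ⟨(S k).head?, l⟩)
    (x := if go (S k).head? then some none else none) (fun _ => rfl) hy)⟩
  simp only [popLoop, TM2.step, TM2.stepAux, redirectCfg, Option.elim, joinStacks_inl]
  rw [update_joinStacks_inl]

theorem runs_popLoop_stop {S T : K → List A} {n : ℕ} (hgo : go (S k).head? = false)
    (h : (c (S k).head?).Runs (update S k (S k).tail) T n) : (popLoop k c go).Runs S T (n + 1) :=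
  fun x => by
    obtain ⟨y, hy⟩ := reach_popLoop (go := go) h x
    rw [hgo] at hy
    exact ⟨y, hy⟩

theorem runs_popLoop_go {S T U : K → List A} {m n : ℕ} (hgo : go (S k).head? = true)
    (h : (c (S k).head?).Runs (update S k (S k).tail) T n) (h' : (popLoop k c go).Runs T U m) :
    (popLoop k c go).Runs S U (n + 1 + m) := fun x => by
  obtain ⟨y, hy⟩ := reach_popLoop (go := go) h x
  rw [hgo] at hy
  obtain ⟨z, hz⟩ := h' y
  exact ⟨z, hy.trans hz⟩

end popLoop

end Frag

/-! ### Subroutine calls -/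

/-- The statement of subroutine `i` as a statement of the program: it acts on the `i`-th stacks
and on the `i`-th component of the state. -/
def liftStmt (i : ι) :
    TM2.Stmt (O i).Γ (O i).Λ (O i).σ → TM2.Stmt (StackAlph K A O) (O i).Λ (IntState A O)
  | .push k g q => .push (.inr ⟨i, k⟩) (fun v => g (v.2 i)) (liftStmt i q)
  | .peek k g q =>
    .peek (.inr ⟨i, k⟩) (fun v x => (v.1, update v.2 i (g (v.2 i) x))) (liftStmt i q)
  | .pop k g q =>
    .pop (.inr ⟨i, k⟩) (fun v x => (v.1, update v.2 i (g (v.2 i) x))) (liftStmt i q)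
  | .load g q => .load (fun v => (v.1, update v.2 i (g (v.2 i)))) (liftStmt i q)
  | .branch g q₁ q₂ => .branch (fun v => g (v.2 i)) (liftStmt i q₁) (liftStmt i q₂)
  | .goto l => .goto fun v => l (v.2 i)
  | .halt => .halt

/-- A configuration of subroutine `i` as a configuration of the program, with register `x` and
work stacks `S`. -/
def liftCfg (x : Option A) (S : K → List A) (i : ι) (c : TM2.Cfg (O i).Γ (O i).Λ (O i).σ) :
    TM2.Cfg (StackAlph K A O) (O i).Λ (IntState A O) :=
  ⟨c.l, (x, update (idleState O) i c.var), joinStacks S (update (idleStacks O) i c.stk)⟩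

theorem stepAux_liftStmt (x : Option A) (S : K → List A) (i : ι)
    (q : TM2.Stmt (O i).Γ (O i).Λ (O i).σ) (v : (O i).σ) (T : ∀ k, List ((O i).Γ k)) :
    TM2.stepAux (liftStmt i q) (x, update (idleState O) i v)
        (joinStacks S (update (idleStacks O) i T)) =
      liftCfg x S i (TM2.stepAux q v T) := by
  induction q generalizing v T with
  | push k g q ih =>
    simp only [liftStmt, TM2.stepAux, joinStacks_inr, update_self]
    rw [update_joinStacks_inr, update_idem, update_self, ih]
  | pop k g q ih =>
    simp only [liftStmt, TM2.stepAux, joinStacks_inr, update_self]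
    rw [update_joinStacks_inr, update_idem, update_idem, update_self, ih]
  | branch g q₁ q₂ ih₁ ih₂ =>
    simp only [liftStmt, TM2.stepAux, update_self]; cases g v <;> simp [ih₁, ih₂]
  | peek k g q ih => simp [liftStmt, ih]
  | load g q ih => simp [liftStmt, ih]
  | goto l => simp [liftStmt, liftCfg]
  | halt => rfl

theorem Reach.lift (x : Option A) (S : K → List A) {i : ι} {n : ℕ}
    {a b : TM2.Cfg (O i).Γ (O i).Λ (O i).σ} (h : Reach (O i).m n a b) :
    Reach (fun l => liftStmt i ((O i).m l)) n (liftCfg x S i a) (liftCfg x S i b) := by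
  induction h with
  | refl => exact .refl _ _
  | @head n a b c hs _ ih =>
    refine .head ?_ ih
    obtain ⟨_ | l, v, T⟩ := a
    · cases hs
    · simp only [TM2.step, Option.some.injEq] at hs
      simp only [liftCfg, TM2.step, stepAux_liftStmt, hs]

theorem initList_eq (tm : FinTM2) (w : List (tm.Γ tm.k₀)) :
    initList tm w = ⟨some tm.main, tm.initialState, update (fun _ => []) tm.k₀ w⟩ := by
  unfold initList
  congr 1
  funext k
  by_cases h : k = tm.k₀
  · subst h; simp
  · simp [h]

theorem haltList_eq (tm : FinTM2) (w : List (tm.Γ tm.k₁)) :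
    haltList tm w = ⟨none, tm.initialState, update (fun _ => []) tm.k₁ w⟩ := by
  unfold haltList
  congr 1
  funext k
  by_cases h : k = tm.k₁
  · subst h; simp
  · simp [h]

namespace Frag

variable [Inhabited A]

/-- Move the contents of the work stack `k` to the input stack of subroutine `i`, with the
symbols translated by `e`. -/
def moveIn (i : ι) (e : A → (O i).Γ (O i).k₀) (k : K) : Frag K A O where
  Λ := Unit
  fin := inferInstance
  entry := ()
  code _ := .pop (.inl k) (fun v x => (x, v.2)) (.branch (fun v => v.1.isSome)
    (.push (.inr ⟨i, (O i).k₀⟩) (fun v => e (v.1.getD default)) (.goto fun _ => ())) .halt)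

/-- Move the contents of the output stack of subroutine `i` to the work stack `k`, with the
symbols translated by `e`. -/
def moveOut (i : ι) (e : (O i).Γ (O i).k₁ → A) (k : K) : Frag K A O where
  Λ := Unit
  fin := inferInstance
  entry := ()
  code _ := .pop (.inr ⟨i, (O i).k₁⟩) (fun v x => (x.map e, v.2)) (.branch (fun v => v.1.isSome)
    (.push (.inl k) (fun v => v.1.getD default) (.goto fun _ => ())) .halt)

/-- The code of subroutine `i`. -/
def subroutine (i : ι) : Frag K A O where
  Λ := (O i).Λ
  fin := (O i).ΛFin
  entry := (O i).main
  code l := liftStmt i ((O i).m l)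

theorem exec_moveIn (i : ι) (e : A → (O i).Γ (O i).k₀) (k : K) (u : List A) (x : Option A)
    (S : K → List A) (w : List ((O i).Γ (O i).k₀)) (hu : S k = u) :
    (moveIn i e k).Exec (u.length + 1) (x, idleState O)
      (joinStacks S (update (idleStacks O) i (update (fun _ => []) (O i).k₀ w))) (none, idleState O)
      (joinStacks (update S k []) (update (idleStacks O) i
        (update (fun _ => []) (O i).k₀ ((u.map e).reverse ++ w)))) := by
  induction u generalizing x S w with
  | nil =>
    refine Reach.single ?_
    simp only [moveIn, TM2.step, TM2.stepAux, joinStacks_inl, hu]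
    rw [update_joinStacks_inl]
    simp
  | cons a u ih =>
    refine Reach.head ?_ (b := ⟨some (), (some a, idleState O), joinStacks (update S k u)
      (update (idleStacks O) i (update (fun _ => []) (O i).k₀ (e a :: w)))⟩) ?_
    · simp only [moveIn, TM2.step, TM2.stepAux, joinStacks_inl, hu]
      rw [update_joinStacks_inl]
      simp only [List.head?_cons, Option.isSome_some, cond_true, Option.getD_some, joinStacks_inr,
        List.tail_cons]
      rw [update_joinStacks_inr]
      simp
    · have := ih (some a) (update S k u) (e a :: w) (by simp)
      change Exec (moveIn i e k) _ _ _ _ _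
      simpa using this

theorem exec_moveOut (i : ι) (e : (O i).Γ (O i).k₁ → A) (k : K) (w : List ((O i).Γ (O i).k₁))
    (x : Option A) (S : K → List A) :
    (moveOut i e k).Exec (w.length + 1) (x, idleState O)
      (joinStacks S (update (idleStacks O) i (update (fun _ => []) (O i).k₁ w))) (none, idleState O)
      (joinStacks (update S k ((w.map e).reverse ++ S k)) (idleStacks O)) := by
  induction w generalizing x S with
  | nil =>
    refine Reach.single ?_
    simp only [moveOut, TM2.step, TM2.stepAux, joinStacks_inr]
    rw [update_joinStacks_inr]
    have : update (idleStacks O) i (fun _ => []) = idleStacks O := update_eq_self _ _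
    simp [this]
  | cons a w ih =>
    refine Reach.head ?_ (b := ⟨some (), (some (e a), idleState O),
      joinStacks (update S k (e a :: S k))
      (update (idleStacks O) i (update (fun _ => []) (O i).k₁ w))⟩) ?_
    · simp only [moveOut, TM2.step, TM2.stepAux, joinStacks_inr]
      rw [update_joinStacks_inr]
      simp only [update_self, List.head?_cons, Option.map_some, Option.isSome_some, cond_true,
        Option.getD_some, joinStacks_inl]
      rw [update_joinStacks_inl]
      simp
    · have := ih (some (e a)) (update S k (e a :: S k))
      change Exec (moveOut i e k) _ _ _ _ _
      simpa using this

/-- Call subroutine `i` on the word on the work stack `kin`, read from the bottom to the top, and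
put its output on top of the work stack `kout`, the last symbol topmost. -/
def call (i : ι) (e : A → (O i).Γ (O i).k₀) (e' : (O i).Γ (O i).k₁ → A) (kin kout : K) :
    Frag K A O :=
  (moveIn i e kin).seq ((subroutine i).seq (moveOut i e' kout))

theorem runs_call {i : ι} {e : A → (O i).Γ (O i).k₀} {e' : (O i).Γ (O i).k₁ → A} {kin kout : K}
    {S : K → List A} {u : List A} {w' : List ((O i).Γ (O i).k₁)} {n : ℕ} (hu : S kin = u)
    (h : TM2OutputsInTime (O i) (u.map e).reverse (some w') n) :
    (call i e e' kin kout).Runs S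
      (update (update S kin []) kout ((w'.map e').reverse ++ update S kin [] kout))
      (u.length + n + w'.length + 2) := fun x => by
  have hsub : (subroutine i).Exec n (none, idleState O)
      (joinStacks (update S kin []) (update (idleStacks O) i
        (update (fun _ => []) (O i).k₀ ((u.map e).reverse ++ []))))
      (none, idleState O) (joinStacks (update S kin []) (update (idleStacks O) i
        (update (fun _ => []) (O i).k₁ w'))) := by
    have h1 := (Reach.of_iterate h.evals_in_steps).mono h.steps_le_m
    have h2 := h1.lift (none : Option A) (update S kin [])
    rw [haltList_eq, initList_eq] at h2
    have h3 : update (idleState O) i (O i).initialState = idleState O := update_eq_self _ _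
    simp only [liftCfg, h3] at h2
    simpa [Exec, subroutine] using h2
  have hin := exec_moveIn i e kin u x S [] hu
  have h3 : update (idleStacks O) i (update (fun _ => []) (O i).k₀ []) = idleStacks O := by
    rw [show update (fun k => ([] : List ((O i).Γ k))) (O i).k₀ [] = fun _ => [] from
      update_eq_self _ _]
    exact update_eq_self _ _
  rw [h3] at hin
  exact ⟨none, Reach.mono (hin.seq (hsub.seq (exec_moveOut i e' kout w' none _))) (by omega)⟩

end Frag

end Frag

/-! ### From program fragments to machines -/

section Machine

variable {K A ι : Type} [DecidableEq K] [DecidableEq ι] {O : ι → FinTM2}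
variable [Fintype K] [Fintype A] [Fintype ι] [Inhabited A]

/-- The code of `F`, followed by popping a symbol `a` from the work stack `kout` and pushing `e a` on
the output stack of subroutine `i`. -/
def Frag.outputCode (F : Frag K A O) (kout : K) (i : ι) (e : A → (O i).Γ (O i).k₁) :
    Option F.Λ → TM2.Stmt (StackAlph K A O) (Option F.Λ) (IntState A O)
  | some l => redirect some (some none) (F.code l)
  | none => .pop (.inl kout) (fun v x => (x, v.2)) (.push (.inr ⟨i, (O i).k₁⟩)
      (fun v => e (v.1.getD default)) (.load (fun v => (none, v.2)) .halt))

theorem Frag.reach_outputCode {F : Frag K A O} {S : K → List A} {kout : K} (i : ι)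
    (e : A → (O i).Γ (O i).k₁) {a : A} {n : ℕ} (h : F.Runs S (update (fun _ => []) kout [a]) n) :
    Reach (F.outputCode kout i e) (n + 1)
      ⟨some (some F.entry), (none, idleState O), joinStacks S (idleStacks O)⟩
      ⟨none, (none, idleState O), joinStacks (fun _ => [])
        (update (idleStacks O) i (update (fun _ => []) (O i).k₁ [e a]))⟩ := by
  obtain ⟨y, hy⟩ := h none
  refine (Reach.redirect (M' := F.outputCode kout i e) (f := some) (x := some none)
    (fun _ => rfl) hy).trans (Reach.single ?_)
  simp only [redirectCfg, Frag.outputCode, Option.elim, TM2.step, TM2.stepAux, joinStacks_inl,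
    update_self]
  rw [update_joinStacks_inl]
  simp only [List.head?_cons, Option.getD_some, joinStacks_inr, List.tail_cons, update_idem]
  rw [update_joinStacks_inr]
  rw [show update (fun _ : K => ([] : List A)) kout [] = fun _ => [] from update_eq_self _ _]
  rfl

/-- The machine that receives its input on the work stack `kin`, runs `F`, pops a symbol `a` from
the work stack `kout`, and outputs `e a` on the output stack of subroutine `i`. The output stack
has to be a stack of a subroutine because all work stacks have the alphabet of the input. -/
@[reducible] def Frag.toFinTM2 (F : Frag K A O) (kin kout : K) (i : ι)
    (e : A → (O i).Γ (O i).k₁) : FinTM2 where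
  K := StackIdx K O
  kFin := by have := fun i => (O i).kFin; infer_instance
  k₀ := .inl kin
  k₁ := .inr ⟨i, (O i).k₁⟩
  Γ := StackAlph K A O
  Λ := Option F.Λ
  main := some F.entry
  ΛFin := by have := F.fin; infer_instance
  σ := IntState A O
  initialState := (none, idleState O)
  σFin := by have := fun i => (O i).σFin; infer_instance
  Γk₀Fin := inferInstanceAs (Fintype A)
  m := F.outputCode kout i e

theorem joinStacks_nil : joinStacks (fun _ : K => ([] : List A)) (idleStacks O) = fun _ => [] := by
  funext j
  rcases j with j | j <;> rfl

theorem Frag.outputs_toFinTM2 {F : Frag K A O} {kin kout : K} {i : ι}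
    {e : A → (O i).Γ (O i).k₁} {w : List A} {a : A} {n : ℕ}
    (h : F.Runs (update (fun _ => []) kin w) (update (fun _ => []) kout [a]) n) :
    Nonempty (TM2OutputsInTime (F.toFinTM2 kin kout i e) w (some [e a]) (n + 1)) := by
  have h3 := Frag.reach_outputCode i e h
  have hinit : initList (F.toFinTM2 kin kout i e) w = ⟨some (some F.entry), (none, idleState O),
      joinStacks (update (fun _ => []) kin w) (idleStacks O)⟩ := by
    refine (initList_eq _ _).trans ?_
    rw [← update_joinStacks_inl, joinStacks_nil]
  have hhalt : haltList (F.toFinTM2 kin kout i e) [e a] =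
      ⟨none, (none, idleState O), joinStacks (fun _ => [])
        (update (idleStacks O) i (update (fun _ => []) (O i).k₁ [e a]))⟩ := by
    refine (haltList_eq _ _).trans ?_
    have := update_joinStacks_inr (fun _ : K => ([] : List A)) (idleStacks O) i (O i).k₁ [e a]
    rw [joinStacks_nil] at this
    exact congrArg _ this
  rw [← hinit, ← hhalt] at h3
  obtain ⟨k, hk, hk'⟩ := h3.exists_iterate
  exact ⟨⟨⟨k, hk'⟩, hk⟩⟩

/-- A function with values in `Bool` is computable in polynomial time if a program fragment leaves
its value on the work stack `kout`, with all other work stacks empty. -/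
theorem Frag.nonempty_tm2ComputableInPolyTime {α : Type} {ea : α → List A} {f : α → Bool}
    (F : Frag K A O) (kin kout : K) (i : ι) (e : (O i).Γ (O i).k₁ ≃ Bool) (d : Bool → A)
    (hd : Injective d) (P : Polynomial ℕ)
    (h : ∀ t, F.Runs (update (fun _ => []) kin (ea t)) (update (fun _ => []) kout [d (f t)])
      (P.eval (ea t).length)) :
    Nonempty (TM2ComputableInPolyTime ea Computability.encodeBool f) := by
  classical
  refine ⟨⟨⟨F.toFinTM2 kin kout i fun a => e.symm (invFun d a), Equiv.refl A, e⟩, P + 1,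
    fun t => ?_⟩⟩
  have := (outputs_toFinTM2 (e := fun a => e.symm (invFun d a)) (i := i) (h t)).some
  simp only [leftInverse_invFun hd (f t)] at this
  simpa [Computability.encodeBool] using this

end Machine

/-! ### A library of program fragments -/

section Library

variable {K A ι : Type} [DecidableEq K] [DecidableEq ι] {O : ι → FinTM2} [Fintype A]

namespace Frag

theorem Runs.congr {F : Frag K A O} {S T T' : K → List A} {m n : ℕ} (h : F.Runs S T m)
    (hT : T = T') (hmn : m ≤ n) : F.Runs S T' n := hT ▸ h.mono hmn

theorem Runs.of_eq {F : Frag K A O} {S S' T : K → List A} {n : ℕ}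
    (h : F.Runs S T n) (hS : S' = S) : F.Runs S' T n := hS ▸ h

/-- Pop a symbol from the work stack `k` and run `c` on it, or on `none` if `k` is empty. -/
def popCase (k : K) (c : Option A → Frag K A O) : Frag K A O := popLoop k c fun _ => false

theorem runs_popCase {k : K} {c : Option A → Frag K A O} {S T : K → List A} {n : ℕ}
    (h : (c (S k).head?).Runs (update S k (S k).tail) T n) : (popCase k c).Runs S T (n + 1) :=
  runs_popLoop_stop rfl h

/-- Pop the symbols from the work stack `k`, running `body` on each of them, until `k` is empty. -/
def forEach (k : K) (body : A → Frag K A O) : Frag K A O :=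
  popLoop k (fun o => o.elim skip body) Option.isSome

/-- The rule for loops: `st i` describes the work stacks after `i` rounds. -/
theorem runs_forEach {k : K} {body : A → Frag K A O} {S T : K → List A} (st : ℕ → K → List A)
    {N b : ℕ} (hS : st 0 = S) (hT : st N = T) (h0 : st N k = [])
    (h : ∀ i < N, ∃ a l, st i k = a :: l ∧ (body a).Runs (update (st i) k l) (st (i + 1)) b) :
    (forEach k body).Runs S T (N * (b + 1) + 2) := by
  subst hS hT
  suffices H : ∀ j ≤ N, (forEach k body).Runs (st (N - j)) (st N) (j * (b + 1) + 2) by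
    simpa using H N le_rfl
  intro j hj
  induction j with
  | zero =>
    refine (runs_popLoop_stop (n := 1) ?_ ?_).mono (by omega)
    · simp [h0]
    · rw [Nat.sub_zero, h0]
      have : update (st N) k [].tail = st N := by rw [List.tail_nil, ← h0, update_eq_self]
      rw [this]
      exact runs_skip _
  | succ j ih =>
    obtain ⟨a, l, hal, hr⟩ := h (N - (j + 1)) (by omega)
    refine (runs_popLoop_go (n := b) (T := st (N - j)) ?_ ?_ (ih (by omega))).mono ?_
    · simp [hal]
    · rw [hal]
      rw [show N - (j + 1) + 1 = N - j by omega] at hr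
      exact hr
    · ring_nf; omega

/-- Push the symbol `a` on all work stacks in `ds`. -/
def pushAll (ds : List K) (a : A) : Frag K A O := ds.foldr (fun d F => (push d a).seq F) skip

theorem runs_pushAll {ds : List K} (hd : ds.Nodup) (a : A) (S : K → List A) :
    (pushAll ds a : Frag K A O).Runs S (fun j => if j ∈ ds then a :: S j else S j)
      (ds.length + 1) := by
  induction ds generalizing S with
  | nil => exact (runs_skip S).congr (by simp) le_rfl
  | cons d ds ih =>
    rw [List.nodup_cons] at hd
    refine ((runs_push d a S).seq (ih hd.2 _)).congr ?_ (by simp; omega)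
    funext j
    by_cases h : j = d
    · subst h; simp [hd.1]
    · simp [h]

/-- Move the contents of the work stack `k` to each of the work stacks in `ds`, with the symbols
translated by `g`; this reverses the order of the symbols. -/
def pour (k : K) (g : A → A) (ds : List K) : Frag K A O := forEach k fun a => pushAll ds (g a)

theorem runs_pour {k : K} (g : A → A) {ds : List K} (hk : k ∉ ds) (hd : ds.Nodup)
    (S : K → List A) :
    (pour k g ds : Frag K A O).Runs S
      (fun j => if j = k then [] else if j ∈ ds then ((S k).map g).reverse ++ S j else S j)
      ((S k).length * (ds.length + 2) + 2) := by
  refine runs_forEach (fun i j => if j = k then (S k).drop i else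
      if j ∈ ds then (((S k).take i).map g).reverse ++ S j else S j)
    (N := (S k).length) (b := ds.length + 1) ?_ ?_ (by simp) fun i hi => ?_
  · funext j
    by_cases h : j = k <;> simp [h]
  · simp
  · refine ⟨(S k)[i], (S k).drop (i + 1),
      (if_pos rfl).trans (List.drop_eq_getElem_cons hi), (runs_pushAll hd _ _).congr ?_ le_rfl⟩
    funext j
    by_cases h : j = k
    · subst h; simp [hk]
    · have ht : (S k).take (i + 1) = (S k).take i ++ [(S k)[i]] := by simp
      by_cases h' : j ∈ ds <;> simp only [h, h', ht, update_of_ne, if_true, if_false, ne_eq,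
        not_false_eq_true, List.map_append, List.reverse_append]
      rfl

/-- Put a copy of the work stack `k` on top of the work stack `d`, using the auxiliary stack
`t`. -/
def copy (k t d : K) : Frag K A O :=
  (pour k id [t]).seq (pour t id [k, d])

theorem runs_copy {k t d : K}
    (hnd : [k, t, d].Nodup) {S : K → List A} (ht : S t = []) :
    (copy k t d : Frag K A O).Runs S (update S d (S k ++ S d)) ((S k).length * 7 + 4) := by
  simp only [List.nodup_cons, List.mem_cons, List.not_mem_nil, not_or, not_false_eq_true,
    or_false] at hnd
  obtain ⟨⟨hkt, hkd⟩, htd, -⟩ := hnd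
  refine ((runs_pour id (by simpa using hkt) (by simp) S).seq
    (runs_pour id (by simp [Ne.symm hkt, htd]) (by simp [hkd]) _)).congr ?_ ?_
  · funext j
    simp only [update_apply, List.mem_cons, List.map_id, List.not_mem_nil, or_false]
    grind
  · simp [ht, Ne.symm hkt]; omega

/-- Empty the work stacks in `ks`. -/
def clear (ks : List K) : Frag K A O := ks.foldr (fun k F => (pour k id []).seq F) skip

theorem runs_clear (ks : List K) {S : K → List A} {B : ℕ} (hB : ∀ k, (S k).length ≤ B) :
    (clear ks : Frag K A O).Runs S (fun j => if j ∈ ks then [] else S j)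
      (ks.length * (2 * B + 2) + 1) := by
  induction ks generalizing S with
  | nil => exact (runs_skip S).congr (by simp) (by simp)
  | cons k ks ih =>
    refine ((runs_pour id (by simp) (by simp) S).seq (ih (fun j => ?_))).congr ?_ ?_
    · by_cases h : j = k <;> simp [h, hB]
    · funext j
      by_cases h : j = k <;> simp [h]
    · have := hB k
      simp only [List.length_nil, List.length_cons]
      ring_nf
      omega

/-- Move the symbols with property `p` from the work stack `k` to the work stack `d`, up to the
first symbol without this property, which is discarded. -/
def moveWhile (k d : K) (p : A → Bool) : Frag K A O :=
  popLoop k (fun o => (o.filter p).elim skip (push d)) fun o => o.any p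

theorem runs_moveWhile {k d : K} {p : A → Bool} (hkd : k ≠ d) {l r : List A} {a : A}
    {S : K → List A} (hS : S k = l ++ a :: r) (hl : ∀ x ∈ l, p x = true) (ha : p a = false) :
    (moveWhile k d p : Frag K A O).Runs S (update (update S k r) d (l.reverse ++ S d))
      (l.length * 2 + 2) := by
  induction l generalizing S with
  | nil =>
    refine (runs_popLoop_stop (n := 1) ?_ ?_).mono (by omega)
    · simp [hS, ha]
    · have : update (update S k r) d (S d) = update S k r := by
        rw [← update_of_ne hkd.symm r S, update_eq_self]
      simpa [hS, ha, Option.filter, this] using runs_skip (O := O) (update S k r)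
  | cons x l ih =>
    have hx : p x = true := hl x (by simp)
    refine (runs_popLoop_go (n := 1) (T := update (update S k (l ++ a :: r)) d (x :: S d)) ?_ ?_
      (ih ?_ fun y hy => hl y (by simp [hy]))).congr ?_ ?_
    · simp [hS, hx]
    · have := runs_push (O := O) d x (update S k (l ++ a :: r))
      simpa [hS, hx, Option.filter, hkd.symm] using this
    · simp [hkd]
    · funext j
      simp only [update_apply]
      grind
    · simp only [List.length_cons]; omega

/-- For each symbol on the work stack `c`, move one symbol from the work stack `k` to the work
stack `d`, as long as there is one; a copy of `c` ends up on the work stack `t`. -/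
def moveMany (c k d t : K) : Frag K A O :=
  forEach c fun a => (push t a).seq (popCase k fun o => o.elim skip (push d))

theorem runs_moveMany {c k d t : K} (hnd : [c, k, d, t].Nodup) {a : A} {q : ℕ} {S : K → List A}
    (hc : S c = List.replicate q a) (ht : S t = []) :
    (moveMany c k d t : Frag K A O).Runs S
      (update (update (update (update S c []) k ((S k).drop q)) d (((S k).take q).reverse ++ S d)) t
        (List.replicate q a)) (q * 4 + 2) := by
  simp only [List.nodup_cons, List.mem_cons, List.not_mem_nil, not_or, not_false_eq_true,
    or_false] at hnd
  obtain ⟨⟨hck, hcd, hct⟩, ⟨hkd, hkt⟩, hdt, -⟩ := hnd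
  refine runs_forEach (fun i => update (update (update (update S c (List.replicate (q - i) a)) k
      ((S k).drop i)) d (((S k).take i).reverse ++ S d)) t (List.replicate i a))
    (N := q) (b := 3) ?_ (by simp) (by simp [hck, hcd, hct]) fun i hi => ?_
  · funext j
    simp only [update_apply]
    grind
  refine ⟨a, List.replicate (q - (i + 1)) a, ?_, ?_⟩
  · rw [← List.replicate_succ]; simp [hck, hcd, hct]; omega
  refine ((runs_push t a _).seq (runs_popCase (n := 1) ?_)).mono le_rfl
  rcases hS : (S k).drop i with _ | ⟨x, l⟩
  · have h1 : (S k).length ≤ i := by simpa using hS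
    -- the stack `k` is exhausted, and the round only copies the counter
    have h2 : (S k).take (i + 1) = (S k).take i := by
      rw [List.take_of_length_le h1, List.take_of_length_le (by omega)]
    have h3 : (S k).drop (i + 1) = [] := by simp; omega
    rw [h2, h3]
    convert runs_skip (K := K) (A := A) (O := O) _ using 1
    · simp [hkt, hkd, Ne.symm hck]
    · funext j
      simp only [update_apply, List.replicate_succ]
      grind
  · have hi' : i < (S k).length := by
      by_contra hcon
      rw [List.drop_of_length_le (by omega)] at hS
      cases hS
    rw [List.drop_eq_getElem_cons hi'] at hS
    obtain ⟨rfl, rfl⟩ := List.cons.inj hS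
    convert runs_push (O := O) d (S k)[i] _ using 1
    · simp [hkt, hkd, Ne.symm hck, hi']
    · funext j
      simp only [update_apply, List.replicate_succ, List.take_add_one]
      grind

/-- Unary multiplication: for each symbol on `acc`, a copy of `num` is added to `t`. -/
def mul (num acc t t' : K) : Frag K A O :=
  (forEach acc fun _ => (pour num id [t, t']).seq (pour t' id [num])).seq (pour t id [acc])

theorem runs_mul {num acc t t' : K} (hnd : [num, acc, t, t'].Nodup) {a : A} {n p : ℕ}
    {S : K → List A} (hnum : S num = List.replicate n a) (hacc : S acc = List.replicate p a)
    (ht : S t = []) (ht' : S t' = []) :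
    (mul num acc t t' : Frag K A O).Runs S (update S acc (List.replicate (p * n) a))
      (10 * (p + 1) * (n + 1)) := by
  simp only [List.nodup_cons, List.mem_cons, List.not_mem_nil, not_or, not_false_eq_true,
    or_false] at hnd
  obtain ⟨⟨hna, hnt, hnt'⟩, ⟨hat, hat'⟩, htt', -⟩ := hnd
  have h1 : (forEach acc fun _ => (pour num id [t, t']).seq (pour t' id [num]) :
      Frag K A O).Runs S (update (update S acc []) t (List.replicate (p * n) a))
      (p * (7 * n + 4 + 1) + 2) := by
    refine runs_forEach (fun i => update (update S acc (List.replicate (p - i) a)) t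
      (List.replicate (i * n) a)) ?_ (by simp) (by simp [hat]) fun i hi => ?_
    · funext j
      simp only [update_apply]
      grind
    refine ⟨a, List.replicate (p - (i + 1)) a, ?_, ?_⟩
    · rw [← List.replicate_succ]; simp [hat]; omega
    refine ((runs_pour id (by simp [*]) (by simp [*]) _).seq
      (runs_pour id (by simp [Ne.symm hnt']) (by simp) _)).congr ?_ ?_
    · funext j
      simp only [update_apply, Nat.add_mul, List.replicate_add, List.mem_cons, List.map_id,
        List.not_mem_nil, or_false, one_mul, Nat.add_comm i 1]
      grind
    · simp [*, Ne.symm hnt', Ne.symm hat', Ne.symm htt']; omega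
  refine (h1.seq (runs_pour id (by simpa using Ne.symm hat) (by simp) _)).congr ?_ ?_
  · funext j
    simp only [update_apply, List.mem_cons, List.map_id, List.not_mem_nil, or_false]
    grind
  · simp
    nlinarith

/-- Polynomials can be evaluated in unary, in polynomial time; the fragment follows Horner's
scheme. -/
theorem exists_runs_polynomial {num acc t t' : K} (hnd : [num, acc, t, t'].Nodup) (a : A)
    (P : Polynomial ℕ) : ∃ (F : Frag K A O) (B : Polynomial ℕ), ∀ (n : ℕ) (S : K → List A),
      S num = List.replicate n a → S acc = [] → S t = [] → S t' = [] →
        F.Runs S (update S acc (List.replicate (P.eval n) a)) (B.eval n) := by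
  have hnd' := hnd
  simp only [List.nodup_cons, List.mem_cons, List.not_mem_nil, not_or, not_false_eq_true,
    or_false] at hnd'
  obtain ⟨⟨hna, hnt, hnt'⟩, ⟨hat, hat'⟩, htt', -⟩ := hnd'
  induction P using Polynomial.recOnHorner with
  | M0 =>
    refine ⟨skip, 1, fun n S _ hacc _ _ => (runs_skip S).congr ?_ (by simp)⟩
    rw [Polynomial.eval_zero, List.replicate_zero, ← hacc, update_eq_self]
  | MC P c _ _ ih =>
    obtain ⟨F, B, hF⟩ := ih
    have hpush : ∀ c : ℕ, ∃ G : Frag K A O, ∀ (m : ℕ) (S : K → List A),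
        S acc = List.replicate m a → G.Runs S (update S acc (List.replicate (m + c) a)) (c + 1) := by
      intro c
      induction c with
      | zero => exact ⟨skip, fun m S hS => (runs_skip S).congr (by simp [← hS]) le_rfl⟩
      | succ c ih =>
        obtain ⟨G, hG⟩ := ih
        refine ⟨(push acc a).seq G, fun m S hS => ((runs_push acc a S).seq
          (hG (m + 1) _ ?_)).congr ?_ (by omega)⟩
        · simp [hS, List.replicate_succ]
        · rw [update_idem, show m + 1 + c = m + (c + 1) by omega]
    obtain ⟨G, hG⟩ := hpush c
    refine ⟨F.seq G, B + Polynomial.C (c + 1), fun n S h1 h2 h3 h4 =>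
      ((hF n S h1 h2 h3 h4).seq (hG (P.eval n) _ (by simp))).congr ?_ ?_⟩
    · simp
    · simp
  | MX P _ ih =>
    obtain ⟨F, B, hF⟩ := ih
    refine ⟨F.seq (mul num acc t t'), B + 10 * (P + 1) * (Polynomial.X + 1),
      fun n S h1 h2 h3 h4 => ((hF n S h1 h2 h3 h4).seq (runs_mul hnd (a := a) (n := n) (p := P.eval n)
        ?_ ?_ ?_ ?_)).congr ?_ ?_⟩
    all_goals simp [*, Ne.symm hat, Ne.symm hat']

end Frag

end Library

/-! ### The amplified verifier and its program -/

theorem eval_mono (P : Polynomial ℕ) {m n : ℕ} (h : m ≤ n) : P.eval m ≤ P.eval n := by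
  simp only [Polynomial.eval_eq_sum_range]
  gcongr

/-- The number of the first `m` blocks of length `q` of the string `r` on which `V`, run on `η` and
`X`, accepts. If `r` is shorter than `m * q`, the last blocks are truncated or empty. -/
def acceptCount (V : List Bool × List Bool × List Bool → Bool) (q m : ℕ) (η X r : List Bool) : ℕ :=
  (List.range m).countP fun i => V (η, X, (r.drop (i * q)).take q)

/-- The verifier that runs `V` on `m` successive blocks of `q` coins, and accepts if the number of
accepting runs, increased by `d`, reaches the threshold `a`; here `q`, `m`, `d` are evaluated at
`|η|` and `a` at `(|η|, m)`. -/
def amplify (V : List Bool × List Bool × List Bool → Bool) (q m d : Polynomial ℕ) (a : ℕ × ℕ → ℕ)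
    (t : List Bool × List Bool × List Bool) : Bool :=
  decide (a (t.1.length, m.eval t.1.length) ≤
    acceptCount V (q.eval t.1.length) (m.eval t.1.length) t.1 t.2.1 t.2.2 + d.eval t.1.length)

/-- The work stacks of the amplified verifier: the input (later the unused coins), the strings `η`
and `X`, the numbers `|η|`, `q`, `m`, the running count, and the threshold in unary, the word
handed to a subroutine, two auxiliary stacks, and the answer. -/
inductive WorkStack
  | inp | eta | wit | num | len | reps | cnt | thr | word | tmp | tmp' | ans
  deriving DecidableEq

instance : Fintype WorkStack :=
  ⟨{.inp, .eta, .wit, .num, .len, .reps, .cnt, .thr, .word, .tmp, .tmp', .ans},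
    fun x => by cases x <;> decide⟩

open WorkStack Frag

section Program

variable {ι : Type} [DecidableEq ι] {O : ι → FinTM2}

/-- The unary digit. -/
abbrev one : Option Bool := some true

/-- One run of the subroutine `i` on `η`, `X` and the next block of coins. -/
def oneRun (i : ι) (e : Option Bool → (O i).Γ (O i).k₀) (e' : (O i).Γ (O i).k₁ → Option Bool) :
    Frag WorkStack (Option Bool) O :=
  (copy eta tmp word).seq <| (push word none).seq <| (copy wit tmp word).seq <|
  (push word none).seq <| (moveMany len inp word tmp).seq <| (pour tmp id [len]).seq <|
  (call i e e' word tmp).seq <| popCase tmp fun o => if o = some one then push cnt one else skip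

theorem runs_oneRun {i : ι} (e : (O i).Γ (O i).k₀ ≃ Option Bool) (e' : (O i).Γ (O i).k₁ ≃ Bool)
    {V : List Bool × List Bool × List Bool → Bool} {time : Polynomial ℕ}
    (hV : ∀ t, Nonempty (TM2OutputsInTime (O i) ((encodeTriple t).map e.symm)
      (some ((Computability.encodeBool (V t)).map e'.symm)) (time.eval (encodeTriple t).length)))
    {η X r : List Bool} {q : ℕ} {S : WorkStack → List (Option Bool)}
    (hη : S eta = (η.map some).reverse) (hX : S wit = (X.map some).reverse)
    (hr : S inp = r.map some) (hq : S len = List.replicate q one) (hword : S word = [])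
    (htmp : S tmp = []) :
    (oneRun i e.symm fun x => some (e' x)).Runs S
      (update (update S inp ((r.drop q).map some)) cnt
        (if V (η, X, r.take q) then one :: S cnt else S cnt))
      (100 * (η.length + X.length + q + 1) + time.eval (η.length + X.length + q + 2)) := by
  have hw : encodeTriple (η, X, r.take q) = (((r.map some).take q).reverse ++
      none :: ((X.map some).reverse ++ none :: (η.map some).reverse)).reverse := by
    simp [encodeTriple, List.map_take]
  have hlen : (encodeTriple (η, X, r.take q)).length ≤ η.length + X.length + q + 2 := by
    simp [encodeTriple]; omega
  have htime := eval_mono time hlen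
  obtain ⟨hV⟩ := hV (η, X, r.take q)
  rw [hw, List.map_reverse] at hV
  rw [hw] at htime hlen
  have hlast : (popCase tmp fun o => if o = some one then push cnt one else skip :
      Frag WorkStack (Option Bool) O).Runs
      (update (update S inp ((r.drop q).map some)) tmp [some (V (η, X, r.take q))])
      (update (update S inp ((r.drop q).map some)) cnt
        (if V (η, X, r.take q) then one :: S cnt else S cnt)) 2 := by
    refine runs_popCase (n := 1) ?_
    cases hb : V (η, X, r.take q)
    · convert runs_skip (K := WorkStack) (A := Option Bool) (O := O) _ using 1
      · simp
      · funext j; cases j <;> simp [htmp]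
    · convert runs_push (K := WorkStack) (A := Option Bool) (O := O) cnt one _ using 1
      · simp
      · funext j; cases j <;> simp [htmp]
  refine ((runs_copy (by decide) htmp).seq <| (runs_push word none _).seq <|
    (runs_copy (by decide) ?_).seq <| (runs_push word none _).seq <|
    (runs_moveMany (by decide) (a := one) (q := q) ?_ ?_).seq <|
    (runs_pour id (by decide) (by decide) _).seq <|
    (runs_call ?_ hV).seq <| hlast.of_eq ?_).mono ?_
  · simp [htmp]
  · simp [hq]
  · simp [htmp]
  · simp [hη, hX, hr, hword]
  · funext j
    cases j <;> simp [*, Computability.encodeBool, List.map_drop]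
  · simp [hη, hX, Computability.encodeBool] at htime hlen ⊢
    omega

end Program

open WorkStack Frag

section Program

variable {ι : Type} [DecidableEq ι] {O : ι → FinTM2}

/-- The contents of the work stacks before a run of `V`: `r` are the unused coins, `k` runs are to
be done, `c` is the count so far, and `a` the threshold. -/
def roundStacks (η X r : List Bool) (q k c a : ℕ) : WorkStack → List (Option Bool)
  | inp => r.map some
  | eta => (η.map some).reverse
  | wit => (X.map some).reverse
  | len => List.replicate q one
  | reps => List.replicate k one
  | cnt => List.replicate c one
  | thr => List.replicate a one
  | _ => []

/-- Read the input, compute `|η|`, `q`, `m`, `d` with the fragments `qF`, `mF`, `dF`, and let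
subroutine `j` compute the threshold. -/
def setup (j : ι) (e : Option Bool → (O j).Γ (O j).k₀) (e' : (O j).Γ (O j).k₁ → Option Bool)
    (qF mF dF : Frag WorkStack (Option Bool) O) : Frag WorkStack (Option Bool) O :=
  (moveWhile inp eta Option.isSome).seq <| (moveWhile inp wit Option.isSome).seq <|
  (copy eta tmp tmp').seq <| (pour tmp' (fun _ => one) [num]).seq <| qF.seq <| mF.seq <| dF.seq <|
  (pour num id [word]).seq <| (push word (some false)).seq <| (copy reps tmp word).seq <|
  call j e e' word thr

/-- `F` computes `p` in unary from the work stack `num` to the work stack `k`, in time `B`. -/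
def Evaluates (F : Frag WorkStack (Option Bool) O) (k : WorkStack) (p B : Polynomial ℕ) : Prop :=
  ∀ (n : ℕ) (S : WorkStack → List (Option Bool)), S num = List.replicate n one → S k = [] →
    S tmp = [] → S tmp' = [] → F.Runs S (update S k (List.replicate (p.eval n) one)) (B.eval n)

theorem runs_setup {j : ι} (e : (O j).Γ (O j).k₀ ≃ Bool) (e' : (O j).Γ (O j).k₁ ≃ Bool)
    {a : ℕ × ℕ → ℕ} {time : Polynomial ℕ}
    (ha : ∀ t, Nonempty (TM2OutputsInTime (O j) ((encodeUnaryPair t).map e.symm)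
      (some ((List.replicate (a t) true).map e'.symm)) (time.eval (encodeUnaryPair t).length)))
    {qF mF dF : Frag WorkStack (Option Bool) O} {q m d qB mB dB : Polynomial ℕ}
    (hq : Evaluates qF len q qB) (hm : Evaluates mF reps m mB) (hd : Evaluates dF cnt d dB)
    (η X r : List Bool) :
    (setup j (fun x => e.symm (x.getD false)) (fun x => some (e' x)) qF mF dF).Runs
      (update (fun _ => []) inp (encodeTriple (η, X, r)))
      (roundStacks η X r (q.eval η.length) (m.eval η.length) (d.eval η.length)
        (a (η.length, m.eval η.length)))
      (100 * (η.length + X.length + m.eval η.length + 1) + qB.eval η.length + mB.eval η.length +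
        dB.eval η.length + time.eval (η.length + m.eval η.length + 1) +
        a (η.length, m.eval η.length)) := by
  have ha := (ha (η.length, m.eval η.length)).some
  have hw : (encodeUnaryPair (η.length, m.eval η.length)).map e.symm =
      ((List.replicate (m.eval η.length) one ++ some false :: List.replicate η.length one).map
        fun x => e.symm (x.getD false)).reverse := by
    simp [encodeUnaryPair]
  have hlen : (encodeUnaryPair (η.length, m.eval η.length)).length =
      η.length + m.eval η.length + 1 := by simp [encodeUnaryPair]; omega
  rw [hw, hlen] at ha
  have hconst : η.map ((fun _ => one) ∘ some) = List.replicate η.length one := by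
    simp [List.map_eq_replicate_iff]
  have hsome : ∀ l : List Bool, ∀ x ∈ l.map some, x.isSome = true := by
    rintro l x hx
    obtain ⟨b, -, rfl⟩ := List.mem_map.1 hx
    rfl
  refine ((runs_moveWhile (by decide) (a := none) (l := η.map some)
      (r := X.map some ++ none :: r.map some) ?_ (hsome η) rfl).seq <|
    (runs_moveWhile (by decide) (a := none) (l := X.map some) (r := r.map some) ?_ (hsome X) rfl).seq <|
    (runs_copy (by decide) ?_).seq <| (runs_pour _ (by decide) (by decide) _).seq <|
    (hq η.length _ ?_ ?_ ?_ ?_).seq <| (hm η.length _ ?_ ?_ ?_ ?_).seq <|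
    (hd η.length _ ?_ ?_ ?_ ?_).seq <| (runs_pour id (by decide) (by decide) _).seq <|
    (runs_push word (some false) _).seq <| (runs_copy (by decide) ?_).seq <|
    runs_call ?_ ha).congr ?_ ?_
  case refine_18 =>
    funext k
    cases k <;> simp [roundStacks]
  case refine_19 => simp; omega
  all_goals simp [encodeTriple, hconst]

/-- Compare the count with the threshold, and clean up. -/
def conclude : Frag WorkStack (Option Bool) O :=
  (forEach cnt fun _ => popCase thr fun _ => skip).seq <|
  (popCase thr fun o => push ans (some o.isNone)).seq <|
  clear [inp, eta, wit, num, len, reps, cnt, thr, word, tmp, tmp']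

theorem runs_conclude (η X r : List Bool) (q c a : ℕ) :
    (conclude : Frag WorkStack (Option Bool) O).Runs (roundStacks η X r q 0 c a)
      (update (fun _ => []) ans [some (decide (a ≤ c))])
      (100 * (η.length + X.length + r.length + q + c + a + 1)) := by
  have h1 : (forEach cnt fun _ => popCase thr fun _ => skip : Frag WorkStack (Option Bool) O).Runs
      (roundStacks η X r q 0 c a) (roundStacks η X r q 0 0 (a - c)) (c * (2 + 1) + 2) := by
    refine runs_forEach (fun i => roundStacks η X r q 0 (c - i) (a - i)) (by simp) (by simp)
      (by simp [roundStacks]) fun i hi => ⟨one, List.replicate (c - (i + 1)) one, ?_, ?_⟩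
    · rw [← List.replicate_succ]; simp [roundStacks]; omega
    · refine runs_popCase (n := 1) ((runs_skip _).congr ?_ le_rfl)
      funext k
      cases k <;> simp [roundStacks]
      omega
  have h2 : (popCase thr fun o => push ans (some o.isNone) : Frag WorkStack (Option Bool) O).Runs
      (roundStacks η X r q 0 0 (a - c)) (update (roundStacks η X r q 0 0 (a - c - 1)) ans
        [some (decide (a ≤ c))]) 2 := by
    refine runs_popCase (n := 1) ((runs_push _ _ _).congr ?_ le_rfl)
    funext k
    cases k <;> simp [roundStacks]
    rcases h : a - c with _ | b
    · simp; omega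
    · simp [List.replicate_succ]; omega
  refine (h1.seq (h2.seq (runs_clear _ (B := η.length + X.length + r.length + q + a + 1)
    fun k => ?_))).congr ?_ ?_
  · cases k <;> simp [roundStacks] <;> omega
  · funext k
    cases k <;> simp
  · simp; omega

/-- The program of the amplified verifier. -/
def amplifyProg (i j : ι) (e : Option Bool → (O i).Γ (O i).k₀)
    (e' : (O i).Γ (O i).k₁ → Option Bool) (f : Option Bool → (O j).Γ (O j).k₀)
    (f' : (O j).Γ (O j).k₁ → Option Bool) (qF mF dF : Frag WorkStack (Option Bool) O) :
    Frag WorkStack (Option Bool) O :=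
  (setup j f f' qF mF dF).seq ((forEach reps fun _ => oneRun i e e').seq conclude)

theorem runs_rounds {i : ι} (e : (O i).Γ (O i).k₀ ≃ Option Bool) (e' : (O i).Γ (O i).k₁ ≃ Bool)
    {V : List Bool × List Bool × List Bool → Bool} {time : Polynomial ℕ}
    (hV : ∀ t, Nonempty (TM2OutputsInTime (O i) ((encodeTriple t).map e.symm)
      (some ((Computability.encodeBool (V t)).map e'.symm)) (time.eval (encodeTriple t).length)))
    (η X r : List Bool) (q m d a : ℕ) :
    (forEach reps fun _ => oneRun i e.symm fun x => some (e' x)).Runs (roundStacks η X r q m d a)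
      (roundStacks η X (r.drop (m * q)) q 0 (acceptCount V q m η X r + d) a)
      (m * (100 * (η.length + X.length + q + 1) + time.eval (η.length + X.length + q + 2) + 1) +
        2) := by
  refine runs_forEach (fun k => roundStacks η X (r.drop (k * q)) q (m - k)
    (acceptCount V q k η X r + d) a) (by simp [acceptCount]) (by simp) (by simp [roundStacks])
    fun k hk => ⟨one, List.replicate (m - (k + 1)) one, ?_, ?_⟩
  · rw [← List.replicate_succ]; simp [roundStacks]; omega
  · refine (runs_oneRun e e' hV (η := η) (X := X) (r := r.drop (k * q)) (q := q) ?_ ?_ ?_ ?_ ?_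
      ?_).congr ?_ le_rfl
    all_goals try rfl
    funext l
    cases l <;> simp [roundStacks, Nat.add_mul]
    simp only [acceptCount, List.range_succ, List.countP_append, List.countP_singleton]
    split_ifs
    · rw [Nat.add_right_comm, List.replicate_succ]
    · simp

end Program

/-- Amplification of a polynomial-time verifier yields a polynomial-time verifier. The threshold has
to be polynomially bounded, since it is copied to a work stack of its own. -/
theorem isPolyTimeVerifier_amplify {V : List Bool × List Bool × List Bool → Bool}
    (hV : IsPolyTimeVerifier V) (q m d : Polynomial ℕ) {a : ℕ × ℕ → ℕ}
    (ha : Nonempty (TM2ComputableInPolyTime encodeUnaryPair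
      (fun k : ℕ => List.replicate k true) a)) {A : Polynomial ℕ}
    (hA : ∀ n, a (n, m.eval n) ≤ A.eval n) : IsPolyTimeVerifier (amplify V q m d a) := by
  obtain ⟨hV⟩ := hV
  obtain ⟨ha⟩ := ha
  -- subroutine `true` computes `V`, and subroutine `false` computes `a`
  let O : Bool → FinTM2 := fun b => match b with
    | true => hV.tm
    | false => ha.tm
  obtain ⟨qF, qB, hq⟩ := exists_runs_polynomial (O := O) (num := num) (acc := len) (t := tmp)
    (t' := tmp') (by decide) one q
  obtain ⟨mF, mB, hm⟩ := exists_runs_polynomial (O := O) (num := num) (acc := reps) (t := tmp)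
    (t' := tmp') (by decide) one m
  obtain ⟨dF, dB, hd⟩ := exists_runs_polynomial (O := O) (num := num) (acc := cnt) (t := tmp)
    (t' := tmp') (by decide) one d
  let e : (O true).Γ (O true).k₀ ≃ Option Bool := hV.inputAlphabet
  let e' : (O true).Γ (O true).k₁ ≃ Bool := hV.outputAlphabet
  let f : (O false).Γ (O false).k₀ ≃ Bool := ha.inputAlphabet
  let f' : (O false).Γ (O false).k₁ ≃ Bool := ha.outputAlphabet
  have hV' : ∀ t, Nonempty (TM2OutputsInTime (O true) ((encodeTriple t).map e.symm)
      (some ((Computability.encodeBool (V t)).map e'.symm))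
      (hV.time.eval (encodeTriple t).length)) := fun t => ⟨hV.outputsFun t⟩
  have ha' : ∀ t, Nonempty (TM2OutputsInTime (O false) ((encodeUnaryPair t).map f.symm)
      (some ((List.replicate (a t) true).map f'.symm))
      (ha.time.eval (encodeUnaryPair t).length)) := fun t => ⟨ha.outputsFun t⟩
  let P : Polynomial ℕ := 100 * (.X + m + 1) + qB + mB + dB + ha.time.comp (.X + m + 1) + A +
    (m * (100 * (.X + q + 1) + hV.time.comp (.X + q + 2) + 1) + 2) + 100 * (.X + q + m + d + A + 1)
  refine (amplifyProg true false e.symm (fun x => some (e' x)) (fun x => f.symm (x.getD false))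
    (fun x => some (f' x)) qF mF dF).nonempty_tm2ComputableInPolyTime inp ans true e' some
    (Option.some_injective _) P ?_
  rintro ⟨η, X, r⟩
  have hL : (encodeTriple (η, X, r)).length = η.length + X.length + r.length + 2 := by
    simp [encodeTriple]; omega
  refine ((runs_setup f f' ha' hq hm hd η X r).seq ((runs_rounds e e' hV' η X r _ _ _ _).seq
    (runs_conclude _ _ _ _ _ _))).mono ?_
  rw [hL]
  set L := η.length + X.length + r.length + 2
  have hn : η.length ≤ L := by omega
  have h1 := eval_mono q hn
  have h2 := eval_mono m hn
  have h3 := eval_mono d hn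
  have h4 := eval_mono qB hn
  have h5 := eval_mono mB hn
  have h6 := eval_mono dB hn
  have h7 := (hA η.length).trans (eval_mono A hn)
  have h8 : ha.time.eval (η.length + m.eval η.length + 1) ≤ ha.time.eval (L + m.eval L + 1) :=
    eval_mono _ (by omega)
  have h9 : hV.time.eval (η.length + X.length + q.eval η.length + 2) ≤
    hV.time.eval (L + q.eval L + 2) := eval_mono _ (by omega)
  have h10 : acceptCount V (q.eval η.length) (m.eval η.length) η X r ≤ m.eval η.length :=
    List.countP_le_length.trans (by simp)
  have h11 : m.eval η.length * (100 * (η.length + X.length + q.eval η.length + 1) +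
      hV.time.eval (η.length + X.length + q.eval η.length + 2) + 1) ≤
      m.eval L * (100 * (L + q.eval L + 1) + hV.time.eval (L + q.eval L + 2) + 1) :=
    Nat.mul_le_mul h2 (by omega)
  -- the products in `h11` are atoms for `omega`; everything else is linear
  simp only [P, Polynomial.eval_add, Polynomial.eval_mul, Polynomial.eval_comp, Polynomial.eval_X,
    Polynomial.eval_one, Polynomial.eval_ofNat, List.length_drop]
  omega

/-! ### A Chernoff bound by counting -/

section Chernoff

variable {Ω : Type} [Fintype Ω]

/-- The exponential moment of a single experiment `f` with success probability `p` is at most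
`exp (p * l + l ^ 2)`. -/
theorem sum_exp_indicator_le [Nonempty Ω] (f : Ω → Bool) {l : ℝ} (hl : |l| ≤ 1) :
    ∑ ω, Real.exp (if f ω then l else 0) ≤ Fintype.card Ω *
      Real.exp ((Fintype.card {ω // f ω = true} : ℝ) / Fintype.card Ω * l + l ^ 2) := by
  have hΩ : (0 : ℝ) < Fintype.card Ω := by exact_mod_cast Fintype.card_pos
  set k : ℝ := ((Fintype.card {ω // f ω = true} : ℕ) : ℝ) with hk
  have hk0 : 0 ≤ k / Fintype.card Ω := by positivity
  have hk1 : k / Fintype.card Ω ≤ 1 := by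
    rw [div_le_one hΩ, hk]
    exact_mod_cast Fintype.card_subtype_le _
  have hsum : ∑ ω, Real.exp (if f ω then l else 0) =
      Fintype.card Ω * (1 + k / Fintype.card Ω * (Real.exp l - 1)) := by
    have : ∀ ω, Real.exp (if f ω then l else 0) =
        1 + (if f ω then (1 : ℝ) else 0) * (Real.exp l - 1) := fun ω => by
      split_ifs <;> simp
    simp only [this, Finset.sum_add_distrib, ← Finset.sum_mul]
    rw [Finset.sum_boole, ← Fintype.card_subtype, ← hk]
    field_simp
    simp
  rw [hsum]
  refine mul_le_mul_of_nonneg_left ?_ hΩ.le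
  have h1 := (abs_le.1 (Real.abs_exp_sub_one_sub_id_le hl)).2
  have h2 : k / Fintype.card Ω * (Real.exp l - 1 - l) ≤ l ^ 2 :=
    (mul_le_mul_of_nonneg_left h1 hk0).trans (mul_le_of_le_one_left (sq_nonneg l) hk1)
  have h3 := Real.add_one_le_exp (k / Fintype.card Ω * (Real.exp l - 1))
  have h4 : Real.exp (k / Fintype.card Ω * (Real.exp l - 1)) ≤
      Real.exp (k / Fintype.card Ω * l + l ^ 2) := Real.exp_le_exp.2 (by linarith)
  linarith

/-- Chernoff's bound for `m` independent runs of the experiment `f`, with parameter `l`: events on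
which the number of successes deviates by `2 * m * |l|` from its mean in the direction of the sign
of `l` have probability at most `exp (-m * l ^ 2)`. -/
theorem card_deviation_le [Nonempty Ω] (f : Ω → Bool) (m : ℕ) {l : ℝ} (hl : |l| ≤ 1)
    (E : (Fin m → Ω) → Prop) [DecidablePred E]
    (hE : ∀ ρ, E ρ → m * ((Fintype.card {ω // f ω = true} : ℝ) / Fintype.card Ω * l + 2 * l ^ 2) ≤
      l * Fintype.card {i // f (ρ i) = true}) :
    (Fintype.card {ρ // E ρ} : ℝ) ≤ Fintype.card Ω ^ m * Real.exp (-(m * l ^ 2)) := by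
  set μ : ℝ := (Fintype.card {ω // f ω = true} : ℝ) / Fintype.card Ω
  have hexp : ∀ ρ : Fin m → Ω, ∏ i, Real.exp (if f (ρ i) then l else 0) =
      Real.exp (l * Fintype.card {i // f (ρ i) = true}) := fun ρ => by
    rw [← Real.exp_sum, Fintype.card_subtype, ← Finset.sum_filter, Finset.sum_const, nsmul_eq_mul,
      mul_comm]
  have h1 : Fintype.card {ρ // E ρ} * Real.exp (m * (μ * l + 2 * l ^ 2)) ≤
      ∑ ρ : Fin m → Ω, ∏ i, Real.exp (if f (ρ i) then l else 0) := by
    rw [Fintype.card_subtype, ← nsmul_eq_mul, ← Finset.sum_const]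
    calc _ ≤ ∑ ρ with E ρ, ∏ i, Real.exp (if f (ρ i) then l else 0) :=
          Finset.sum_le_sum fun ρ hρ => by
            rw [hexp]
            exact Real.exp_le_exp.2 (hE ρ (Finset.mem_filter.1 hρ).2)
      _ ≤ _ := Finset.sum_le_sum_of_subset_of_nonneg (Finset.filter_subset _ _)
            fun ρ _ _ => Finset.prod_nonneg fun i _ => (Real.exp_pos _).le
  rw [← Fintype.sum_pow fun ω => Real.exp (if f ω then l else 0)] at h1
  have h2 := h1.trans (pow_le_pow_left₀ (Finset.sum_nonneg fun _ _ => (Real.exp_pos _).le)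
    (sum_exp_indicator_le f hl) m)
  rw [mul_pow, ← Real.exp_nat_mul, ← le_div_iff₀ (Real.exp_pos _), mul_div_assoc,
    ← Real.exp_sub] at h2
  have h3 : m * (μ * l + l ^ 2) - m * (μ * l + 2 * l ^ 2) = -(m * l ^ 2) := by ring
  rwa [h3] at h2

end Chernoff

section Blocks

variable (V : List Bool × List Bool × List Bool → Bool) (q m : ℕ) (η X : List Bool)

theorem acceptCount_ofFn (r : Fin (m * q) → Bool) :
    acceptCount V q m η X (List.ofFn r) = Fintype.card {i : Fin m //
      V (η, X, List.ofFn fun j : Fin q => r (finProdFinEquiv (i, j))) = true} := by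
  have hblock : ∀ i : Fin m, ((List.ofFn r).drop (i * q)).take q =
      List.ofFn fun j : Fin q => r (finProdFinEquiv (i, j)) := fun i => by
    have hi : i * q + q ≤ m * q := by
      rw [← Nat.succ_mul]; exact Nat.mul_le_mul_right q i.2
    refine List.ext_getElem (by simp; omega) fun j h1 h2 => ?_
    simp only [List.getElem_take, List.getElem_drop, List.getElem_ofFn]
    congr 1
    ext
    simp [finProdFinEquiv, Nat.mul_comm, Nat.add_comm]
  simp only [← hblock]
  generalize List.ofFn r = r'
  rw [acceptCount, Fintype.card_subtype, Finset.card_filter, Fin.sum_univ_eq_sum_range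
    (fun i => if V (η, X, (r'.drop (i * q)).take q) = true then 1 else 0)]
  clear hblock r
  induction m with
  | zero => simp
  | succ m ih =>
    rw [List.range_succ, List.countP_append, ih, Finset.sum_range_succ, List.countP_singleton]

/-- The Chernoff bound for the number of accepting runs of `V` on a random string of `m` blocks. -/
theorem card_acceptCount_le {l : ℝ} (hl : |l| ≤ 1) (E : ℕ → Prop) [DecidablePred E]
    (hE : ∀ k, E k → m * (acceptProb V q η X * l + 2 * l ^ 2) ≤ l * k) :
    (Fintype.card {r : Fin (m * q) → Bool // E (acceptCount V q m η X (List.ofFn r))} : ℝ) /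
      2 ^ (m * q) ≤ Real.exp (-(m * l ^ 2)) := by
  let e : (Fin (m * q) → Bool) ≃ (Fin m → Fin q → Bool) :=
    (finProdFinEquiv.arrowCongr (Equiv.refl Bool)).symm.trans (Equiv.curry _ _ _)
  have h1 := card_deviation_le (Ω := Fin q → Bool) (fun ω => V (η, X, List.ofFn ω)) m hl
    (fun ρ => E (Fintype.card {i // V (η, X, List.ofFn (ρ i)) = true})) fun ρ hρ => by
      simpa [acceptProb] using hE _ hρ
  have h2 : Fintype.card {r : Fin (m * q) → Bool // E (acceptCount V q m η X (List.ofFn r))} =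
      Fintype.card {ρ : Fin m → Fin q → Bool //
        E (Fintype.card {i // V (η, X, List.ofFn (ρ i)) = true})} :=
    Fintype.card_congr (e.subtypeEquiv fun r => by rw [acceptCount_ofFn]; rfl)
  rw [h2, div_le_iff₀ (by positivity), mul_comm]
  simpa [← pow_mul, Nat.mul_comm] using h1

end Blocks

/-! ### The threshold one half -/

/-- The program that computes `⌊m / 2⌋` from `1ⁿ 0 1ᵐ` in unary: it drops the symbols up to the first
`0`, and then pushes a `1` on the output stack for every two symbols on the input stack. -/
def halfCode : Bool → TM2.Stmt (fun _ : Bool => Bool) Bool (Option Bool)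
  | false => .pop false (fun _ x => x) (.branch (fun v => v == some true) (.goto fun _ => false)
      (.load (fun _ => none) (.goto fun _ => true)))
  | true => .pop false (fun _ x => x) (.pop false (fun _ x => x) (.branch Option.isSome
      (.push true (fun _ => true) (.goto fun _ => true)) .halt))

/-- The machine with the program `halfCode`; `false` is its input stack, and `true` its output
stack. -/
@[reducible] def halfMachine : FinTM2 where
  K := Bool
  k₀ := false
  k₁ := true
  Γ _ := Bool
  Λ := Bool
  main := false
  σ := Option Bool
  initialState := none
  Γk₀Fin := inferInstanceAs (Fintype Bool)
  m := halfCode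

/-- Stack contents of the machine, given by the input and the output stack. -/
def halfStacks (u w : List Bool) : Bool → List Bool
  | false => u
  | true => w

theorem update_halfStacks_false (u w l : List Bool) :
    update (halfStacks u w) false l = halfStacks l w := by
  funext b; cases b <;> rfl

theorem update_halfStacks_true (u w l : List Bool) :
    update (halfStacks u w) true l = halfStacks u l := by
  funext b; cases b <;> rfl

theorem reach_halfCode_true (m : ℕ) (v : Option Bool) (w : List Bool) :
    Reach halfCode (m / 2 + 1) ⟨some true, v, halfStacks (List.replicate m true) w⟩
      ⟨none, none, halfStacks [] (List.replicate (m / 2) true ++ w)⟩ := by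
  induction m using Nat.strong_induction_on generalizing v w with
  | _ m ih =>
    match m with
    | 0 | 1 =>
      refine Reach.single ?_
      simp [halfCode, halfStacks, update_halfStacks_false]
    | m + 2 =>
      have h := ih m (by omega) (some true) (true :: w)
      rw [show true :: w = [true] ++ w from rfl, ← List.append_assoc,
        show List.replicate (m / 2) true ++ [true] = List.replicate ((m + 2) / 2) true by
          rw [← List.replicate_succ', Nat.add_div_right _ (by norm_num)]] at h
      refine (Reach.head ?_ h).mono (by omega)
      simp [halfCode, halfStacks, update_halfStacks_false, update_halfStacks_true,
        List.replicate_succ]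

theorem reach_halfCode_false (n m : ℕ) (v : Option Bool) :
    Reach halfCode (n + 1 + (m / 2 + 1))
      ⟨some false, v, halfStacks (encodeUnaryPair (n, m)) []⟩
      ⟨none, none, halfStacks [] (List.replicate (m / 2) true)⟩ := by
  induction n generalizing v with
  | zero =>
    have h := reach_halfCode_true m none []
    rw [List.append_nil] at h
    refine (Reach.head ?_ h).mono (by omega)
    simp [halfCode, halfStacks, update_halfStacks_false, encodeUnaryPair]
  | succ n ih =>
    refine (Reach.head ?_ (ih (some true))).mono (by omega)
    simp [halfCode, halfStacks, update_halfStacks_false, encodeUnaryPair, List.replicate_succ]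

theorem isPolyTimeApproximable_half : IsPolyTimeApproximable fun _ => 1 / 2 := by
  refine ⟨fun t => t.2 / 2, ⟨⟨⟨halfMachine, Equiv.refl Bool, Equiv.refl Bool⟩, .X + 1,
    fun t => ?_⟩⟩, fun n m _ hm => ?_⟩
  · have h := reach_halfCode_false t.1 t.2 none
    have h1 : initList halfMachine (encodeUnaryPair t) =
        ⟨some false, none, halfStacks (encodeUnaryPair t) []⟩ := by
      refine (initList_eq _ _).trans (congrArg _ ?_)
      funext b; cases b <;> rfl
    have h2 : haltList halfMachine (List.replicate (t.2 / 2) true) =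
        ⟨none, none, halfStacks [] (List.replicate (t.2 / 2) true)⟩ := by
      refine (haltList_eq _ _).trans (congrArg _ ?_)
      funext b; cases b <;> rfl
    rw [← h1, ← h2] at h
    have h3 : Nonempty (TM2OutputsInTime halfMachine (encodeUnaryPair t)
        (some (List.replicate (t.2 / 2) true)) ((.X + 1 : Polynomial ℕ).eval
          (encodeUnaryPair t).length)) := by
      obtain ⟨k, hk, hk'⟩ := h.exists_iterate
      refine ⟨⟨⟨k, hk'⟩, hk.trans ?_⟩⟩
      simp [encodeUnaryPair]
      omega
    simpa using h3.some
  · have hm' : (0 : ℝ) < m := by exact_mod_cast hm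
    have h1 : (m : ℝ) = 2 * (m / 2 : ℕ) + (m % 2 : ℕ) := by exact_mod_cast (Nat.div_add_mod m 2).symm
    have h2 : ((m % 2 : ℕ) : ℝ) ≤ 1 := by
      exact_mod_cast Nat.le_of_lt_succ (Nat.mod_lt m (by norm_num))
    have h3 : (0 : ℝ) ≤ (m % 2 : ℕ) := Nat.cast_nonneg _
    rw [show ((m / 2 : ℕ) : ℝ) / m - 1 / 2 = ((m / 2 : ℕ) - m / 2 : ℝ) / m by field_simp, abs_div,
      abs_of_pos hm', div_le_div_iff_of_pos_right hm', abs_le]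
    constructor <;> linarith

/-! ### Amplification -/

theorem MA_mono {c c' s s' : ℕ → ℝ} (hc : ∀ n, 1 ≤ n → c' n ≤ c n) (hs : ∀ n, 1 ≤ n → s n ≤ s' n) :
    MA c s ⊆ MA c' s' := by
  rintro Q ⟨V, p, q, hV, h⟩
  refine ⟨V, p, q, hV, fun η => ?_⟩
  have hn : 1 ≤ η.1.length := List.length_pos_of_ne_nil η.2
  refine ⟨fun hQ => ?_, fun hQ X hX => ((h η).2 hQ X hX).trans (hs _ hn)⟩
  obtain ⟨X, hX, hp⟩ := (h η).1 hQ
  exact ⟨X, hX, (hc _ hn).trans hp⟩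

/-- The amplification step: an efficiently approximable threshold and an inverse polynomial gap
suffice for exponentially small error. -/
theorem MA_subset_of_gap {c s : ℕ → ℝ} (hc : IsPolyTimeApproximable c) (G H : ℕ)
    (hc2 : ∀ n, 1 ≤ n → c n ≤ 2) (hs : ∀ n, 1 ≤ n → s n ≤ c n - 1 / (8 * (n : ℝ) ^ G)) :
    MA c s ⊆ MA (fun n => 1 - Real.exp (-(2 * (n : ℝ) ^ H))) fun n =>
      Real.exp (-(2 * (n : ℝ) ^ H)) := by
  rintro Q ⟨V, p, q, hV, h⟩
  obtain ⟨a, ha, hac⟩ := hc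
  -- with `l = 1 / (64 * n ^ G)` these are `d = 4 * m * l` and `m * l ^ 2 = 2 * n ^ H`: the gap is
  -- `8 * l`, so the slack `d` puts the acceptance threshold in the middle of the gap, and leaves
  -- `2 * m * l` for deviations and `2 * m * l ≥ 1` for the error of the approximation
  let m : Polynomial ℕ := 8192 * .X ^ (2 * G + H)
  let d : Polynomial ℕ := 512 * .X ^ (G + H)
  have hm1 : ∀ n, 1 ≤ n → 1 ≤ m.eval n := fun n hn => by
    simp only [m, Polynomial.eval_mul, Polynomial.eval_ofNat, Polynomial.eval_pow,
      Polynomial.eval_X]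
    have : 0 < n ^ (2 * G + H) := pow_pos hn _
    omega
  have hacm : ∀ n, 1 ≤ n → |(a (n, m.eval n) : ℝ) - m.eval n * c n| ≤ 1 := fun n hn => by
    have hpos : (0 : ℝ) < m.eval n := by exact_mod_cast hm1 n hn
    have := hac n (m.eval n) hn (hm1 n hn)
    rw [show (a (n, m.eval n) : ℝ) / m.eval n - c n =
      (a (n, m.eval n) - m.eval n * c n) / m.eval n by field_simp, abs_div, abs_of_pos hpos] at this
    exact (div_le_div_iff_of_pos_right hpos).1 this
  -- the approximation property says nothing about inputs of length `0`, hence the constant term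
  have hA : ∀ n, a (n, m.eval n) ≤ (2 * m + 1 + .C (a (0, m.eval 0))).eval n := fun n => by
    simp only [Polynomial.eval_add, Polynomial.eval_mul, Polynomial.eval_ofNat,
      Polynomial.eval_one, Polynomial.eval_C]
    rcases Nat.eq_zero_or_pos n with rfl | hn
    · omega
    · have h1 := (abs_le.1 (hacm n hn)).2
      have h2 : ((m.eval n : ℕ) : ℝ) * c n ≤ m.eval n * 2 :=
        mul_le_mul_of_nonneg_left (hc2 n hn) (Nat.cast_nonneg _)
      have : (a (n, m.eval n) : ℝ) ≤ (2 * m.eval n + 1 : ℕ) := by push_cast; linarith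
      have : a (n, m.eval n) ≤ 2 * m.eval n + 1 := by exact_mod_cast this
      omega
  refine ⟨amplify V q m d a, p, m * q, isPolyTimeVerifier_amplify hV q m d ha hA, fun η => ?_⟩
  obtain ⟨hyes, hno⟩ := h η
  set n := η.1.length
  have hn : 1 ≤ n := List.length_pos_of_ne_nil η.2
  have hn' : (1 : ℝ) ≤ n := by exact_mod_cast hn
  have hG : (1 : ℝ) ≤ (n : ℝ) ^ G := one_le_pow₀ hn'
  have hH : (1 : ℝ) ≤ (n : ℝ) ^ H := one_le_pow₀ hn'
  -- the parameter of the Chernoff bound, an eighth of the gap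
  set l : ℝ := 1 / (64 * (n : ℝ) ^ G) with hl
  have hl0 : 0 < l := by positivity
  have hl1 : l ≤ 1 := by
    rw [hl, div_le_one (by positivity)]; linarith
  have hM : ((m.eval n : ℕ) : ℝ) = 8192 * (n : ℝ) ^ (2 * G + H) := by simp [m]
  have hD : ((d.eval n : ℕ) : ℝ) = 4 * (m.eval n * l) := by
    rw [hM, hl]; simp only [d, Polynomial.eval_mul, Polynomial.eval_ofNat, Polynomial.eval_pow,
      Polynomial.eval_X]
    push_cast
    field_simp
    ring
  have hMl : 1 ≤ m.eval n * l := by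
    have : ((m.eval n : ℕ) : ℝ) * l = 128 * ((n : ℝ) ^ G * (n : ℝ) ^ H) := by
      rw [hM, hl]; field_simp; ring
    rw [this]; nlinarith
  have hMl2 : m.eval n * l ^ 2 = 2 * (n : ℝ) ^ H := by
    rw [hM, hl]; field_simp; ring
  have ha1 := abs_le.1 (hacm n hn)
  rw [Polynomial.eval_mul]
  refine ⟨fun hQ => ?_, fun hQ X hX => ?_⟩
  · obtain ⟨X, hX, hp⟩ := hyes hQ
    refine ⟨X, hX, ?_⟩
    have key := card_acceptCount_le V (q.eval n) (m.eval n) η.1 X (l := -l)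
      (by rw [abs_neg, abs_of_pos hl0]; exact hl1)
      (fun k => ¬ a (n, m.eval n) ≤ k + d.eval n) (fun k hk => by
        have hk' : (k : ℝ) + d.eval n < a (n, m.eval n) := by exact_mod_cast not_le.1 hk
        have h3 : ((m.eval n : ℕ) : ℝ) * c n ≤ m.eval n * acceptProb V (q.eval n) η.1 X :=
          mul_le_mul_of_nonneg_left hp (Nat.cast_nonneg _)
        have h4 : (k : ℝ) ≤ m.eval n * acceptProb V (q.eval n) η.1 X - 2 * (m.eval n * l) := by
          linarith
        have := mul_le_mul_of_nonneg_left h4 hl0.le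
        linarith)
    rw [neg_sq, hMl2] at key
    have hcompl : acceptProb (amplify V q m d a) (m.eval n * q.eval n) η.1 X = 1 -
        (Fintype.card {r : Fin (m.eval n * q.eval n) → Bool // ¬ a (n, m.eval n) ≤
          acceptCount V (q.eval n) (m.eval n) η.1 X (List.ofFn r) + d.eval n} : ℝ) /
          2 ^ (m.eval n * q.eval n) := by
      rw [Fintype.card_subtype_compl, Nat.cast_sub (Fintype.card_subtype_le _)]
      simp only [acceptProb, amplify, decide_eq_true_eq]
      rw [sub_div]
      simp
      rfl
    rw [hcompl]
    linarith
  · have hp := (hno hQ X hX).trans (hs n hn)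
    have key := card_acceptCount_le V (q.eval n) (m.eval n) η.1 X (l := l)
      (by rw [abs_of_pos hl0]; exact hl1)
      (fun k => a (n, m.eval n) ≤ k + d.eval n) (fun k hk => by
        have hk' : (a (n, m.eval n) : ℝ) ≤ k + d.eval n := by exact_mod_cast hk
        have hgap : 1 / (8 * (n : ℝ) ^ G) = 8 * l := by rw [hl]; field_simp; norm_num
        rw [hgap] at hp
        have h3 : ((m.eval n : ℕ) : ℝ) * acceptProb V (q.eval n) η.1 X ≤ m.eval n * (c n - 8 * l) :=
          mul_le_mul_of_nonneg_left hp (Nat.cast_nonneg _)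
        have h4 : m.eval n * acceptProb V (q.eval n) η.1 X + 2 * (m.eval n * l) ≤ k := by
          linarith
        have := mul_le_mul_of_nonneg_left h4 hl0.le
        linarith)
    rw [hMl2] at key
    simpa only [acceptProb, amplify, decide_eq_true_eq] using key

end MerlinArthur

open MerlinArthur in
theorem mainTheorem9 (g : ℝ) (hg : 0 ≤ g) :
    (∀ c : ℕ → ℝ, MerlinArthur.IsPolyTimeApproximable c →
      (∀ n : ℕ, 1 ≤ n → 0 < c n ∧ c n - 1 / (n : ℝ) ^ g < 1) →
      MerlinArthur.MA c (fun n => c n - 1 / (n : ℝ) ^ g) ⊆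
        MerlinArthur.MA (fun _ => 2 / 3) (fun _ => 1 / 3)) ∧
    MerlinArthur.MA (fun _ => 2 / 3) (fun _ => 1 / 3) =
      MerlinArthur.MA (fun n => 1 - Real.exp (-(n : ℝ) ^ g)) (fun n => Real.exp (-(n : ℝ) ^ g)) := by
  have hpow : ∀ n : ℕ, 1 ≤ n → 1 ≤ (n : ℝ) ^ g ∧ (n : ℝ) ^ g ≤ (n : ℝ) ^ ⌈g⌉₊ := fun n hn => by
    have hn' : (1 : ℝ) ≤ n := by exact_mod_cast hn
    refine ⟨Real.one_le_rpow hn' hg, ?_⟩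
    rw [← Real.rpow_natCast]
    exact Real.rpow_le_rpow_of_exponent_le hn' (Nat.le_ceil g)
  have he : Real.exp (-1) < 0.375 := by
    rw [Real.exp_neg, inv_lt_comm₀ (Real.exp_pos _) (by norm_num)]
    have := Real.exp_one_gt_d9
    norm_num at this ⊢
    linarith
  have he2 : Real.exp (-2) ≤ 1 / 3 := by
    rw [show (-2 : ℝ) = -1 + -1 by norm_num, Real.exp_add]
    nlinarith [Real.exp_pos (-1)]
  -- exponentially small error is at most `exp (-2) ≤ 1 / 3`
  have hthird : ∀ H : ℕ, MA (fun n => 1 - Real.exp (-(2 * (n : ℝ) ^ H)))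
      (fun n => Real.exp (-(2 * (n : ℝ) ^ H))) ⊆ MA (fun _ => 2 / 3) (fun _ => 1 / 3) := fun H => by
    have h : ∀ n : ℕ, 1 ≤ n → Real.exp (-(2 * (n : ℝ) ^ H)) ≤ 1 / 3 := fun n hn => by
      have : (1 : ℝ) ≤ (n : ℝ) ^ H := one_le_pow₀ (by exact_mod_cast hn)
      exact (Real.exp_le_exp.2 (by linarith)).trans he2
    exact MA_mono (fun n hn => by linarith [h n hn]) h
  refine ⟨fun c hc hcn => ?_, Set.Subset.antisymm ?_ ?_⟩
  · refine (MA_subset_of_gap hc ⌈g⌉₊ 0 (fun n hn => ?_) fun n hn => ?_).trans (hthird 0)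
    -- `c n - 1 / n ^ g < 1` bounds the threshold, and thereby its unary approximation
    · have h1 : 1 / (n : ℝ) ^ g ≤ 1 := by
        rw [div_le_one (by linarith [hpow n hn])]; exact (hpow n hn).1
      linarith [(hcn n hn).2]
    · have : 1 / (8 * (n : ℝ) ^ ⌈g⌉₊) ≤ 1 / (n : ℝ) ^ g :=
        one_div_le_one_div_of_le (by linarith [hpow n hn]) (by linarith [hpow n hn])
      linarith
  · have h1 : MA (fun _ => 2 / 3) (fun _ => 1 / 3) ⊆ MA (fun _ => 1 / 2) (fun _ => 1 / 3) :=
      MA_mono (fun _ _ => by norm_num) fun _ _ => le_rfl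
    refine h1.trans ((MA_subset_of_gap isPolyTimeApproximable_half 0 ⌈g⌉₊ (fun _ _ => by norm_num)
      fun _ _ => by norm_num).trans ?_)
    have h : ∀ n : ℕ, 1 ≤ n → Real.exp (-(2 * (n : ℝ) ^ ⌈g⌉₊)) ≤ Real.exp (-(n : ℝ) ^ g) :=
      fun n hn => Real.exp_le_exp.2 (by linarith [hpow n hn])
    exact MA_mono (fun n hn => by linarith [h n hn]) h
  · have h : ∀ n : ℕ, 1 ≤ n → Real.exp (-(n : ℝ) ^ g) ≤ 0.375 := fun n hn =>
      (Real.exp_le_exp.2 (by linarith [hpow n hn])).trans he.le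
    have h1 : MA (fun n => 1 - Real.exp (-(n : ℝ) ^ g)) (fun n => Real.exp (-(n : ℝ) ^ g)) ⊆
        MA (fun _ => 1 / 2) (fun _ => 0.375) :=
      MA_mono (fun n hn => by have := h n hn; norm_num at this ⊢; linarith) h
    exact h1.trans ((MA_subset_of_gap isPolyTimeApproximable_half 0 0 (fun _ _ => by norm_num)
      fun _ _ => by norm_num).trans (hthird 0))
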